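/- Conventions. Let $n\ge 0$ and let $S_n$ be the group of permutations of $\{1,\dots,n\}$, with $w\in S_n$ written in one-line notation $w(1)w(2)\cdots w(n)$. Let $s_i$ ($1\le i\le n-1$) be the adjacent transposition of $i$ and $i+1$, and let $\ell(w)$ be the least number of $s_i$'s whose product is $w$; a word spelling such a product of length $\ell(w)$ is a reduced word of $w$. The permutation $w$ is fully commutative if any two of its reduced words are connected by interchanges of adjacent letters $i,j$ with $|i-j|>1$. The right weak order $\le$ on $S_n$ is the reflexive and transitive closure of the relations $v<vs_i$ with $\ell(v)<\ell(vs_i)$, where $vs_i$ is $v$ with the letters in positions $i$ and $i+1$ swapped. A set $L$ of integers is uncrowded if $|[y,y+2x]\cap L|\le x+1$ for all integers $x,y$ with $x>0$, and crowded otherwise. A fully commutative permutation $w$ is crowded if the set of entries in the second row of its Robinson–Schensted–Knuth insertion tableau $P(w)$ is crowded; $\mathcal{C}_n$ denotes the set of crowded fully commutative permutations in $S_n$. A descent of $w$ is an $i\in\{1,\dots,n-1\}$ with $w(i)>w(i+1)$. An occurrence in $w$ of a pattern $\sigma\in S_m$ is a subsequence $w(p_1)\cdots w(p_m)$, $p_1<\cdots<p_m$,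 in the same relative order as $\sigma(1)\cdots\sigma(m)$ (and is then called a $\sigma$-pattern); it is consecutive if $p_{j+1}=p_j+1$ for all $j$. Theorem 5.15. A permutation $w\in S_n$ is a minimal element of $\mathcal{C}_n$ with respect to the right weak order if and only if there are integers $d\ge 1$ and $k\ge 2$ such that all of the following hold. (a) The set of descents of $w$ is $\{d,d+2,d+4,\dots,d+2k\}$. (b) The set $\{w(d),w(d+2),\dots,w(d+2k)\}$ is crowded. (c) $w(i)=i$ for all $i\in[1,n]\setminus[d,d+2k+1]$. (d) The pattern $415263$ occurs in $w$, and every occurrence of $415263$ in $w$ is consecutive. (e) For each $i\in[0,k-2]$, the consecutive subsequence $w(d+2i)w(d+2i+1)\cdots w(d+2i+5)$ is a $415263$-pattern or a $315264$-pattern. -/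

import Mathlib

namespace FCPerm

/-! Permutations of `{1, …, n}` are elements of `Equiv.Perm (Fin n)`; the element `i : Fin n`
stands for the number `i + 1`. Positions and values are written with the numbers `1, …, n`
through `letter`. -/

/-- The letter `w(i)` of the one-line notation `w(1) w(2) ⋯ w(n)`, for `1 ≤ i ≤ n`
(outside this range `w` is extended by `w(i) = i`). -/
def letter {n : ℕ} (w : Equiv.Perm (Fin n)) (i : ℕ) : ℕ :=
  if h : 1 ≤ i ∧ i ≤ n then (w ⟨i - 1, by omega⟩ : ℕ) + 1 else i

/-- The one-line notation of `w`, as a word in the letters `1, …, n`. -/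
def oneLine {n : ℕ} (w : Equiv.Perm (Fin n)) : List ℕ :=
  List.ofFn fun i : Fin n => (w i : ℕ) + 1

/-! ### Reduced words, full commutativity, right weak order -/

/-- The simple reflections of `S_n`: the index `i : Fin (n - 1)` stands for `s_{i+1}`, which
swaps the numbers `i + 1` and `i + 2`, that is, the elements `i` and `i + 1` of `Fin n`. -/
def simpleReflection {n : ℕ} (i : Fin (n - 1)) : Equiv.Perm (Fin n) :=
  Equiv.swap ⟨i, by omega⟩ ⟨i + 1, by omega⟩

/-- The product of simple reflections spelled by a word. As usual, products act from the right:
`w * s_i` is obtained from `w` by swapping the letters in positions `i` and `i + 1`. -/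
def wordProd {n : ℕ} (u : List (Fin (n - 1))) : Equiv.Perm (Fin n) :=
  (u.map simpleReflection).prod

/-- The Coxeter length: the least number of simple reflections whose product is `w`. -/
noncomputable def coxeterLength {n : ℕ} (w : Equiv.Perm (Fin n)) : ℕ :=
  sInf {l | ∃ u : List (Fin (n - 1)), wordProd u = w ∧ u.length = l}

/-- `u` is a reduced word of `w`. -/
def IsReducedWord {n : ℕ} (w : Equiv.Perm (Fin n)) (u : List (Fin (n - 1))) : Prop :=
  wordProd u = w ∧ u.length = coxeterLength w

/-- `v` is obtained from `u` by one commutation move: two adjacent letters `i`, `j` with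
`|i - j| > 1` are interchanged. -/
def CommutationMove {m : ℕ} (u v : List (Fin m)) : Prop :=
  ∃ (a b : List (Fin m)) (i j : Fin m), 1 < |((i : ℕ) : ℤ) - ((j : ℕ) : ℤ)| ∧
    u = a ++ i :: j :: b ∧ v = a ++ j :: i :: b

/-- `w` is fully commutative: its reduced words form a single commutation class. -/
def IsFullyCommutative {n : ℕ} (w : Equiv.Perm (Fin n)) : Prop :=
  ∀ u v : List (Fin (n - 1)), IsReducedWord w u → IsReducedWord w v →
    Relation.ReflTransGen CommutationMove u v

/-- The right weak order on `S_n`: the reflexive and transitive closure of the relations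
`v < v s_i` with `ℓ(v) < ℓ(v s_i)`. -/
def RightWeakLE {n : ℕ} : Equiv.Perm (Fin n) → Equiv.Perm (Fin n) → Prop :=
  Relation.ReflTransGen fun v w =>
    ∃ i : Fin (n - 1), w = v * simpleReflection i ∧ coxeterLength v < coxeterLength w

/-! ### The insertion tableau -/

/-- Row insertion of `x` into an increasing row: `x` replaces the leftmost entry larger than `x`,
which is returned as the bumped entry; if there is none, `x` is appended. -/
def rowInsert (x : ℕ) : List ℕ → List ℕ × Option ℕ
  | [] => ([x], none)
  | y :: ys => if x < y then (x :: ys, some y)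
      else (y :: (rowInsert x ys).1, (rowInsert x ys).2)

/-- Insertion of `x` into a tableau, given as the list of its rows: `x` is inserted into the
first row, and an entry that is bumped from a row is inserted into the next one. -/
def tableauInsert (x : ℕ) : List (List ℕ) → List (List ℕ)
  | [] => [[x]]
  | r :: rs => match rowInsert x r with
    | (r₁, none) => r₁ :: rs
    | (r₁, some y) => r₁ :: tableauInsert y rs

/-- The insertion tableau of `w` under the Robinson–Schensted–Knuth algorithm. -/
def insertionTableau {n : ℕ} (w : Equiv.Perm (Fin n)) : List (List ℕ) :=
  (oneLine w).foldl (fun T x => tableauInsert x T) []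

/-- The set of entries in the second row of a tableau (empty if there is no second row). -/
def rowTwo (T : List (List ℕ)) : Set ℤ :=
  {z | ∃ a ∈ T.getD 1 [], z = (a : ℤ)}

/-! ### Crowded sets and crowded permutations -/

/-- A set `L` of integers is uncrowded if `|[y, y + 2x] ∩ L| ≤ x + 1` for all integers `x`, `y`
with `x > 0`. -/
def IsUncrowded (L : Set ℤ) : Prop :=
  ∀ x y : ℤ, 0 < x → ((Set.Icc y (y + 2 * x) ∩ L).ncard : ℤ) ≤ x + 1

/-- A set of integers is crowded if it is not uncrowded. -/
def IsCrowded (L : Set ℤ) : Prop := ¬ IsUncrowded L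

/-- The set of fully commutative permutations in `S_n` whose insertion tableau is crowded, that
is, has a crowded second row. -/
def crowdedFC (n : ℕ) : Set (Equiv.Perm (Fin n)) :=
  {w | IsFullyCommutative w ∧ IsCrowded (rowTwo (insertionTableau w))}

/-- `w` is a minimal element, in the right weak order, of the set of crowded fully commutative
permutations in `S_n`. -/
def IsMinimalCrowded {n : ℕ} (w : Equiv.Perm (Fin n)) : Prop :=
  w ∈ crowdedFC n ∧ ∀ v ∈ crowdedFC n, RightWeakLE v w → v = w

/-! ### Descents and patterns -/

/-- The set of descents of `w`: those `i ∈ {1, …, n - 1}` with `w(i) > w(i + 1)`. -/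
def descents {n : ℕ} (w : Equiv.Perm (Fin n)) : Set ℕ :=
  {i | 1 ≤ i ∧ i < n ∧ letter w (i + 1) < letter w i}

/-- Two sequences of the same length are in the same relative order. -/
def SameRelativeOrder {m : ℕ} (a b : Fin m → ℕ) : Prop :=
  ∀ i j : Fin m, a i < a j ↔ b i < b j

/-- The positions `f(0) < f(1) < ⋯` in `{1, …, n}` carry an occurrence in `w` of the pattern with
one-line notation `p`. -/
def IsOccurrence {m n : ℕ} (p : Fin m → ℕ) (w : Equiv.Perm (Fin n)) (f : Fin m → ℕ) : Prop :=
  StrictMono f ∧ (∀ j, 1 ≤ f j ∧ f j ≤ n) ∧ SameRelativeOrder (fun j => letter w (f j)) p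

/-- A sequence of positions is consecutive if each is one more than its predecessor. -/
def IsConsecutive {m : ℕ} (f : Fin m → ℕ) : Prop :=
  ∀ i j : Fin m, (j : ℕ) = (i : ℕ) + 1 → f j = f i + 1

end FCPerm

/-!
Undoing a descent of a minimal crowded permutation must destroy crowdedness. It would leave the
second row of the tableau unchanged unless the lower letter exceeds the whole first row before it
and the upper letter is smaller than the letter after the descent. Hence the second row consists
of the tops of the descents, and a count of letters between tops shows that every descent but the
last is followed by another one two positions later, whose bottom lies below its top: the descents
form a *block*. In a block the number of bottoms below a top determines the value of the top up to
one inequality, so the set of tops is crowded only if some top exceeds the bottom two steps later,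
and the set of all tops but the last is uncrowded exactly if no top exceeds the bottom three steps
later. The latter condition is also sufficient for minimality: below such a permutation, a crowded
one must still bump the last top, hence, going down, every top by the bottom next to it.
-/

namespace FCPerm

variable {α : Type*} {n : ℕ}

/-! ### The one-line notation as a bijection of `ℕ` -/

/-- The sequence `f` with the entries in positions `p` and `p + 1` swapped. -/
def swapAt (f : ℕ → α) (p : ℕ) : ℕ → α := f ∘ Equiv.swap p (p + 1)

lemma swapAt_left (f : ℕ → α) (p : ℕ) : swapAt f p p = f (p + 1) := by
  simp [swapAt]

lemma swapAt_right (f : ℕ → α) (p : ℕ) : swapAt f p (p + 1) = f p := by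
  simp [swapAt]

lemma swapAt_of_ne (f : ℕ → α) {p q : ℕ} (hp : q ≠ p) (hp' : q ≠ p + 1) : swapAt f p q = f q := by
  rw [swapAt, Function.comp_apply, Equiv.swap_apply_of_ne_of_ne hp hp']

lemma swap_succ_lt_swap_succ_iff {i p q : ℕ} (h : ¬ (p = i ∧ q = i + 1))
    (h' : ¬ (p = i + 1 ∧ q = i)) :
    Equiv.swap i (i + 1) p < Equiv.swap i (i + 1) q ↔ p < q := by
  simp only [Equiv.swap_apply_def]
  split_ifs <;> omega

section Letter

variable (w : Equiv.Perm (Fin n))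

lemma letter_of_mem {i : ℕ} (h : 1 ≤ i ∧ i ≤ n) :
    letter w i = (w ⟨i - 1, by omega⟩ : ℕ) + 1 :=
  dif_pos h

lemma letter_of_notMem {i : ℕ} (h : ¬ (1 ≤ i ∧ i ≤ n)) : letter w i = i :=
  dif_neg h

lemma letter_zero : letter w 0 = 0 :=
  letter_of_notMem w (by omega)

lemma letter_mem {i : ℕ} (h : 1 ≤ i ∧ i ≤ n) : 1 ≤ letter w i ∧ letter w i ≤ n := by
  rw [letter_of_mem w h]
  omega

lemma letter_le_max (i : ℕ) : letter w i ≤ max i n := by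
  by_cases h : 1 ≤ i ∧ i ≤ n
  · exact (letter_mem w h).2.trans (le_max_right _ _)
  · rw [letter_of_notMem w h]
    exact le_max_left _ _

lemma letter_mul (v : Equiv.Perm (Fin n)) (i : ℕ) :
    letter (v * w) i = letter v (letter w i) := by
  by_cases h : 1 ≤ i ∧ i ≤ n
  · rw [letter_of_mem v (letter_mem w h), letter_of_mem _ h]
    simp [letter_of_mem w h]
  · rw [letter_of_notMem w h, letter_of_notMem _ h, letter_of_notMem v h]

lemma letter_one (i : ℕ) : letter (1 : Equiv.Perm (Fin n)) i = i := by
  by_cases h : 1 ≤ i ∧ i ≤ n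
  · rw [letter_of_mem _ h, Equiv.Perm.one_apply]
    exact Nat.sub_add_cancel h.1
  · exact letter_of_notMem _ h

@[simp]
lemma letter_inv_letter (i : ℕ) : letter w⁻¹ (letter w i) = i := by
  rw [← letter_mul, inv_mul_cancel, letter_one]

@[simp]
lemma letter_letter_inv (i : ℕ) : letter w (letter w⁻¹ i) = i := by
  rw [← letter_mul, mul_inv_cancel, letter_one]

lemma letter_injective : Function.Injective (letter w) :=
  Function.LeftInverse.injective (letter_inv_letter w)

lemma letter_surjective : Function.Surjective (letter w) :=
  Function.RightInverse.surjective (letter_letter_inv w)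

variable {w} in
lemma eq_of_letter_eq {v : Equiv.Perm (Fin n)} (h : letter v = letter w) : v = w := by
  ext i
  have hi : 1 ≤ (i : ℕ) + 1 ∧ (i : ℕ) + 1 ≤ n := by omega
  simpa [letter_of_mem _ hi] using congrFun h (i + 1)

variable {w} in
lemma bounds_of_inversion {p q : ℕ} (hpq : p < q) (hlt : letter w q < letter w p) :
    1 ≤ p ∧ q ≤ n := by
  have hp : p ≠ 0 := by
    rintro rfl
    rw [letter_zero] at hlt
    omega
  refine ⟨by omega, ?_⟩
  by_contra hq
  have := letter_le_max w p
  rw [letter_of_notMem w (i := q) (by omega)] at hlt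
  omega

lemma letter_lt_or_gt {p q : ℕ} (hpq : p ≠ q) : letter w p < letter w q ∨ letter w q < letter w p :=
  lt_or_gt_of_ne ((letter_injective w).ne hpq)

lemma letter_simpleReflection (i : Fin (n - 1)) (p : ℕ) :
    letter (simpleReflection i) p = Equiv.swap ((i : ℕ) + 1) (i + 2) p := by
  by_cases h : 1 ≤ p ∧ p ≤ n
  · rw [letter_of_mem _ h, simpleReflection, Equiv.swap_apply_def, Equiv.swap_apply_def]
    simp only [Fin.ext_iff]
    split_ifs <;> simp <;> omega
  · rw [letter_of_notMem _ h, Equiv.swap_apply_of_ne_of_ne] <;> omega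

lemma letter_mul_simpleReflection (i : Fin (n - 1)) :
    letter (w * simpleReflection i) = swapAt (letter w) (i + 1) := by
  ext p
  rw [letter_mul, letter_simpleReflection, swapAt, Function.comp_apply]

lemma simpleReflection_inv (i : Fin (n - 1)) :
    (simpleReflection i)⁻¹ = simpleReflection i :=
  Equiv.swap_inv _ _

lemma mul_simpleReflection_cancel (i : Fin (n - 1)) :
    w * simpleReflection i * simpleReflection i = w := by
  rw [mul_assoc, simpleReflection, Equiv.swap_mul_self, mul_one]

variable {w} in
lemma exists_fin_of_descent {p : ℕ} (h : letter w (p + 1) < letter w p) :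
    ∃ i : Fin (n - 1), (i : ℕ) + 1 = p := by
  have hp := bounds_of_inversion (Nat.lt_succ_self p) h
  exact ⟨⟨p - 1, by omega⟩, Nat.sub_add_cancel hp.1⟩

variable {w} in
lemma exists_descent (h : w ≠ 1) : ∃ p, letter w (p + 1) < letter w p := by
  by_contra! hw
  refine h (eq_of_letter_eq (funext fun i => ?_))
  have hmono : StrictMono (letter w) := strictMono_nat_of_lt_succ fun p =>
    (hw p).lt_of_ne ((letter_injective w).ne (by omega))
  have hmono_inv : StrictMono (letter w⁻¹) := fun a b hab =>
    hmono.lt_iff_lt.1 (by simpa using hab)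
  have hle := hmono_inv.le_apply (x := letter w i)
  rw [letter_inv_letter] at hle
  rw [letter_one]
  exact hle.antisymm hmono.le_apply

end Letter

/-! ### Inversions and the Coxeter length -/

section Inversions

variable {v w : Equiv.Perm (Fin n)}

/-- The inversions of `w`, as pairs of letters: `(a, b)` is an inversion if `b < a` and `a` stands
to the left of `b`. -/
def inversions (w : Equiv.Perm (Fin n)) : Finset (ℕ × ℕ) :=
  (Finset.Icc 1 n ×ˢ Finset.Icc 1 n).filter fun x =>
    x.2 < x.1 ∧ letter w⁻¹ x.1 < letter w⁻¹ x.2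

lemma mem_inversions {a b : ℕ} :
    (a, b) ∈ inversions w ↔ b < a ∧ letter w⁻¹ a < letter w⁻¹ b := by
  simp only [inversions, Finset.mem_filter, Finset.mem_product, Finset.mem_Icc,
    and_iff_right_iff_imp]
  rintro ⟨hba, hlt⟩
  have := bounds_of_inversion hba hlt
  omega

lemma letter_mem_inversions {p q : ℕ} :
    (letter w p, letter w q) ∈ inversions w ↔ p < q ∧ letter w q < letter w p := by
  rw [mem_inversions, letter_inv_letter, letter_inv_letter, and_comm]

lemma inversions_one : inversions (1 : Equiv.Perm (Fin n)) = ∅ := by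
  ext ⟨a, b⟩
  simp only [mem_inversions, inv_one, letter_one, Finset.notMem_empty, iff_false]
  omega

lemma inversions_mul_simpleReflection {i : Fin (n - 1)}
    (h : letter w (i + 1) < letter w (i + 2)) :
    inversions (w * simpleReflection i) =
      insert (letter w (i + 2), letter w (i + 1)) (inversions w) := by
  ext ⟨a, b⟩
  obtain ⟨p, rfl⟩ := letter_surjective w a
  obtain ⟨q, rfl⟩ := letter_surjective w b
  simp only [Finset.mem_insert, Prod.mk.injEq, mem_inversions, mul_inv_rev, simpleReflection_inv,
    letter_mul, letter_simpleReflection, letter_inv_letter, (letter_injective w).eq_iff]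
  by_cases hasc : p = (i : ℕ) + 1 ∧ q = (i : ℕ) + 2
  · obtain ⟨rfl, rfl⟩ := hasc
    simp only [Equiv.swap_apply_left, Equiv.swap_apply_right]
    omega
  by_cases hdesc : p = (i : ℕ) + 2 ∧ q = (i : ℕ) + 1
  · obtain ⟨rfl, rfl⟩ := hdesc
    simp [h]
  rw [swap_succ_lt_swap_succ_iff hasc hdesc]
  tauto

lemma card_inversions_of_ascent {i : Fin (n - 1)} (h : letter w (i + 1) < letter w (i + 2)) :
    (inversions (w * simpleReflection i)).card = (inversions w).card + 1 := by
  rw [inversions_mul_simpleReflection h, Finset.card_insert_of_notMem]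
  rw [letter_mem_inversions]
  omega

lemma ascent_mul_simpleReflection {i : Fin (n - 1)} (h : letter w (i + 2) < letter w (i + 1)) :
    letter (w * simpleReflection i) (i + 1) < letter (w * simpleReflection i) (i + 2) := by
  rwa [letter_mul_simpleReflection, swapAt_left, swapAt_right]

lemma card_inversions_of_descent {i : Fin (n - 1)} (h : letter w (i + 2) < letter w (i + 1)) :
    (inversions w).card = (inversions (w * simpleReflection i)).card + 1 := by
  simpa only [mul_simpleReflection_cancel] using
    card_inversions_of_ascent (ascent_mul_simpleReflection h)

lemma wordProd_concat (u : List (Fin (n - 1))) (i : Fin (n - 1)) :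
    wordProd (n := n) (u ++ [i]) = wordProd u * simpleReflection i := by
  simp [wordProd]

lemma card_inversions_wordProd_le (u : List (Fin (n - 1))) :
    (inversions (wordProd (n := n) u)).card ≤ u.length := by
  induction u using List.reverseRecOn with
  | nil => simp [wordProd, inversions_one]
  | append_singleton u i ih =>
    rw [wordProd_concat, List.length_append, List.length_singleton]
    rcases letter_lt_or_gt (wordProd u) (show (i : ℕ) + 1 ≠ i + 2 by omega) with h | h
    · rw [card_inversions_of_ascent h]
      omega
    · have := card_inversions_of_descent h
      omega

lemma exists_word_length_eq (w : Equiv.Perm (Fin n)) :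
    ∃ u : List (Fin (n - 1)), wordProd u = w ∧ u.length = (inversions w).card := by
  induction hN : (inversions w).card generalizing w with
  | zero =>
    refine ⟨[], ?_, rfl⟩
    by_contra hw
    obtain ⟨p, hp⟩ := exists_descent (w := w) (Ne.symm hw)
    have : (letter w p, letter w (p + 1)) ∈ inversions w :=
      letter_mem_inversions.2 ⟨Nat.lt_succ_self p, hp⟩
    simp [Finset.card_eq_zero.1 hN] at this
  | succ N ih =>
    have hw : w ≠ 1 := by
      rintro rfl
      simp [inversions_one] at hN
    obtain ⟨p, hp⟩ := exists_descent hw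
    obtain ⟨i, rfl⟩ := exists_fin_of_descent hp
    have := card_inversions_of_descent hp
    obtain ⟨u, hu, hl⟩ := ih (w * simpleReflection i) (by omega)
    exact ⟨u ++ [i], by rw [wordProd_concat, hu, mul_simpleReflection_cancel], by simp [hl]⟩

theorem coxeterLength_eq_card_inversions (w : Equiv.Perm (Fin n)) :
    coxeterLength w = (inversions w).card := by
  obtain ⟨u, hu, hl⟩ := exists_word_length_eq w
  refine le_antisymm (Nat.sInf_le ⟨u, hu, hl⟩) (le_csInf ⟨_, u, hu, hl⟩ ?_)
  rintro _ ⟨v, rfl, rfl⟩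
  exact card_inversions_wordProd_le v

lemma exists_reducedWord (w : Equiv.Perm (Fin n)) : ∃ u, IsReducedWord w u := by
  obtain ⟨u, hu, hl⟩ := exists_word_length_eq w
  exact ⟨u, hu, hl.trans (coxeterLength_eq_card_inversions w).symm⟩

lemma coxeterLength_lt_mul_iff {i : Fin (n - 1)} :
    coxeterLength w < coxeterLength (w * simpleReflection i) ↔
      letter w (i + 1) < letter w (i + 2) := by
  rw [coxeterLength_eq_card_inversions, coxeterLength_eq_card_inversions]
  rcases letter_lt_or_gt w (show (i : ℕ) + 1 ≠ i + 2 by omega) with h | h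
  · have := card_inversions_of_ascent h
    omega
  · have := card_inversions_of_descent h
    omega

lemma isReducedWord_concat_iff {u : List (Fin (n - 1))} {i : Fin (n - 1)} :
    IsReducedWord w (u ++ [i]) ↔
      letter w (i + 2) < letter w (i + 1) ∧ IsReducedWord (w * simpleReflection i) u := by
  simp only [IsReducedWord, wordProd_concat, coxeterLength_eq_card_inversions, List.length_append,
    List.length_singleton]
  constructor
  · rintro ⟨rfl, hl⟩
    have hle := card_inversions_wordProd_le (n := n) u
    have hasc : letter (wordProd u) (i + 1) < letter (wordProd (n := n) u) (i + 2) := by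
      refine (letter_lt_or_gt _ (by omega)).resolve_right fun h => ?_
      have := card_inversions_of_descent h
      omega
    have := card_inversions_of_ascent hasc
    rw [mul_simpleReflection_cancel, letter_mul_simpleReflection, swapAt_left, swapAt_right]
    exact ⟨hasc, rfl, by omega⟩
  · rintro ⟨hdesc, hu, hl⟩
    have := card_inversions_of_descent hdesc
    exact ⟨by rw [hu, mul_simpleReflection_cancel], by omega⟩

lemma rightWeakLE_of_descent {i : Fin (n - 1)} (h : letter w (i + 2) < letter w (i + 1)) :
    RightWeakLE (w * simpleReflection i) w := by
  refine Relation.ReflTransGen.single ⟨i, (mul_simpleReflection_cancel w i).symm, ?_⟩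
  have := coxeterLength_lt_mul_iff.2 (ascent_mul_simpleReflection h)
  rwa [mul_simpleReflection_cancel] at this

lemma RightWeakLE.inversions_subset (h : RightWeakLE v w) : inversions v ⊆ inversions w := by
  induction h with
  | refl => exact Finset.Subset.refl _
  | tail _ h ih =>
    obtain ⟨i, rfl, hl⟩ := h
    rw [inversions_mul_simpleReflection (coxeterLength_lt_mul_iff.1 hl)]
    exact ih.trans (Finset.subset_insert _ _)

lemma RightWeakLE.exists_descent_notMem_inversions (h : RightWeakLE v w) (hne : v ≠ w) :
    ∃ p, letter w (p + 1) < letter w p ∧ (letter w p, letter w (p + 1)) ∉ inversions v := by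
  rcases Relation.ReflTransGen.cases_tail h with h | ⟨u, hvu, i, rfl, hl⟩
  · exact absurd h.symm hne
  · rw [coxeterLength_lt_mul_iff] at hl
    refine ⟨i + 1, ?_, fun hv => ?_⟩ <;>
      rw [letter_mul_simpleReflection, swapAt_left, swapAt_right] at *
    · exact hl
    · have := (letter_mem_inversions.1 (RightWeakLE.inversions_subset hvu hv)).1
      omega

lemma RightWeakLE.exists_append (h : RightWeakLE v w) :
    ∃ y, ∀ u, IsReducedWord v u → IsReducedWord w (u ++ y) := by
  induction h with
  | refl => exact ⟨[], fun u hu => by rwa [List.append_nil]⟩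
  | @tail x _ _ h ih =>
    obtain ⟨i, rfl, hl⟩ := h
    obtain ⟨y, hy⟩ := ih
    refine ⟨y ++ [i], fun u hu => ?_⟩
    rw [← List.append_assoc, isReducedWord_concat_iff, mul_simpleReflection_cancel,
      letter_mul_simpleReflection, swapAt_left, swapAt_right]
    exact ⟨coxeterLength_lt_mul_iff.1 hl, hy u hu⟩

end Inversions

/-! ### Full commutativity and the pattern `321` -/

/-- The sequence `f` has no decreasing subsequence of length three. -/
def Avoids321 [LT α] (f : ℕ → α) : Prop :=
  ∀ ⦃p q r⦄, p < q → q < r → f q < f p → ¬ f r < f q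

lemma Avoids321.lt_of_inversion [LinearOrder α] {f : ℕ → α} (h : Avoids321 f)
    (hf : f.Injective) {p q r : ℕ} (hpq : p < q) (hqr : q < r) (hlt : f r < f q) : f p < f q :=
  (not_lt.1 fun hqp => h hpq hqr hqp hlt).lt_of_ne (hf.ne hpq.ne)

lemma swapAt_comm (f : ℕ → α) {p q : ℕ} (hpq : p ≠ q) (hp : p + 1 ≠ q) (hq : q + 1 ≠ p) :
    swapAt (swapAt f p) q = swapAt (swapAt f q) p := by
  ext x
  simp only [swapAt, Function.comp_apply, Equiv.swap_apply_def]
  congr 1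
  split_ifs <;> omega

lemma swapAt_braid (f : ℕ → α) (p : ℕ) :
    swapAt (swapAt (swapAt f p) (p + 1)) p = swapAt (swapAt (swapAt f (p + 1)) p) (p + 1) := by
  ext x
  simp only [swapAt, Function.comp_apply, Equiv.swap_apply_def]
  congr 1
  split_ifs <;> omega

lemma exists_consecutive_321 [LinearOrder α] {f : ℕ → α} (hf : ¬ Avoids321 f)
    (hswap : ∀ p, f (p + 1) < f p → Avoids321 (swapAt f p)) :
    ∃ p, f (p + 2) < f (p + 1) ∧ f (p + 1) < f p := by
  simp only [Avoids321, not_forall, not_not] at hf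
  obtain ⟨p₀, q, r₀, hpq₀, hqr₀, hfp₀, hfr₀⟩ := hf
  obtain ⟨p, ⟨hpq, hfp⟩, hp⟩ : ∃ p, (p < q ∧ f q < f p) ∧ ∀ x < q, f q < f x → x ≤ p := by
    have hne : ((Finset.range q).filter (f q < f ·)).Nonempty := ⟨p₀, by simp [hpq₀, hfp₀]⟩
    obtain ⟨p, hp, hmax⟩ := Finset.exists_max_image _ id hne
    simp only [Finset.mem_filter, Finset.mem_range, and_imp] at hp hmax
    exact ⟨p, hp, hmax⟩
  obtain ⟨r, ⟨hqr, hfr⟩, hr⟩ : ∃ r, (q < r ∧ f r < f q) ∧ ∀ x, q < x → f x < f q → r ≤ x := by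
    have hex : ∃ r, q < r ∧ f r < f q := ⟨r₀, hqr₀, hfr₀⟩
    exact ⟨Nat.find hex, Nat.find_spec hex, fun x hx hfx => Nat.find_min' hex ⟨hx, hfx⟩⟩
  have hp_succ : p + 1 = q := by
    by_contra hne
    have hdesc : f (p + 1) < f p :=
      (not_lt.1 fun h => (hp (p + 1) (by omega) h).not_gt (Nat.lt_succ_self p)).trans_lt hfp
    refine hswap p hdesc (show p + 1 < q by omega) hqr ?_ ?_
    · rwa [swapAt_right, swapAt_of_ne f (by omega) (by omega)]
    · rwa [swapAt_of_ne f (by omega) (by omega), swapAt_of_ne f (by omega) (by omega)]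
  obtain ⟨r, rfl⟩ : ∃ r', r = r' + 1 := ⟨r - 1, by omega⟩
  have hr_eq : q = r := by
    by_contra hne
    have hdesc : f (r + 1) < f r :=
      hfr.trans_le (not_lt.1 fun h => (hr r (by omega) h).not_gt (Nat.lt_succ_self r))
    refine hswap r hdesc hpq (show q < r by omega) ?_ ?_
    · rwa [swapAt_of_ne f (by omega) (by omega), swapAt_of_ne f (by omega) (by omega)]
    · rwa [swapAt_left, swapAt_of_ne f (by omega) (by omega)]
  subst hr_eq hp_succ
  exact ⟨p, hfr, hfp⟩

lemma CommutationMove.append_right {m : ℕ} {u v : List (Fin m)} (h : CommutationMove u v)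
    (x : List (Fin m)) : CommutationMove (u ++ x) (v ++ x) := by
  obtain ⟨a, b, i, j, hij, rfl, rfl⟩ := h
  exact ⟨a, b ++ x, i, j, hij, by simp, by simp⟩

lemma CommutationMove.perm {m : ℕ} {u v : List (Fin m)} (h : CommutationMove u v) : u.Perm v := by
  obtain ⟨a, b, i, j, -, rfl, rfl⟩ := h
  exact List.Perm.append_left _ (List.Perm.swap _ _ _)

lemma reflTransGen_commutationMove_append_right {m : ℕ} {u v : List (Fin m)}
    (h : Relation.ReflTransGen CommutationMove u v) (x : List (Fin m)) :
    Relation.ReflTransGen CommutationMove (u ++ x) (v ++ x) :=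
  h.lift (· ++ x) fun _ _ h => h.append_right x

lemma perm_of_reflTransGen_commutationMove {m : ℕ} {u v : List (Fin m)}
    (h : Relation.ReflTransGen CommutationMove u v) : u.Perm v := by
  induction h with
  | refl => exact List.Perm.refl _
  | tail _ h ih => exact ih.trans h.perm

section FullyCommutative

variable {v w : Equiv.Perm (Fin n)}

lemma avoids321_letter_iff :
    Avoids321 (letter w) ↔ ∀ a b c, (a, b) ∈ inversions w → (b, c) ∉ inversions w := by
  constructor
  · intro h a b c hab hbc
    rw [mem_inversions] at hab hbc
    exact h hab.2 hbc.2 (by simpa using hab.1) (by simpa using hbc.1)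
  · intro h p q r hpq hqr hlt hlt'
    exact h _ _ _ (letter_mem_inversions.2 ⟨hpq, hlt⟩) (letter_mem_inversions.2 ⟨hqr, hlt'⟩)

lemma Avoids321.of_rightWeakLE (hw : Avoids321 (letter w)) (h : RightWeakLE v w) :
    Avoids321 (letter v) := by
  rw [avoids321_letter_iff] at hw ⊢
  exact fun a b c hab hbc => hw a b c (h.inversions_subset hab) (h.inversions_subset hbc)

lemma exists_reducedWord_of_far_descents {i j : Fin (n - 1)}
    (hij : (i : ℕ) + 1 < j ∨ (j : ℕ) + 1 < i)
    (hi : letter w (i + 2) < letter w (i + 1)) (hj : letter w (j + 2) < letter w (j + 1)) :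
    ∃ x, IsReducedWord (w * simpleReflection i) (x ++ [j]) ∧
      IsReducedWord (w * simpleReflection j) (x ++ [i]) := by
  have hcomm : w * simpleReflection i * simpleReflection j =
      w * simpleReflection j * simpleReflection i :=
    eq_of_letter_eq <| by
      simp only [letter_mul_simpleReflection]
      exact swapAt_comm _ (by omega) (by omega) (by omega)
  obtain ⟨x, hx⟩ := exists_reducedWord (w * simpleReflection i * simpleReflection j)
  refine ⟨x, ?_, ?_⟩ <;> rw [isReducedWord_concat_iff, letter_mul_simpleReflection,
    swapAt_of_ne _ (by omega) (by omega), swapAt_of_ne _ (by omega) (by omega)]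
  · exact ⟨hj, hx⟩
  · exact ⟨hi, hcomm ▸ hx⟩

theorem isFullyCommutative_of_avoids321 (hw : Avoids321 (letter w)) : IsFullyCommutative w := by
  intro u v hu hv
  induction hN : u.length generalizing w u v with
  | zero =>
    have hv0 : v.length = 0 := by rw [hv.2, ← hu.2, hN]
    rw [List.length_eq_zero_iff] at hN hv0
    rw [hN, hv0]
  | succ N ih =>
    have hvN : v.length = N + 1 := by rw [hv.2, ← hu.2, hN]
    rcases List.eq_nil_or_concat' u with rfl | ⟨u, i, rfl⟩
    · simp at hN
    rcases List.eq_nil_or_concat' v with rfl | ⟨v, j, rfl⟩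
    · simp at hvN
    rw [List.length_append, List.length_singleton, Nat.add_right_cancel_iff] at hN hvN
    rw [isReducedWord_concat_iff] at hu hv
    have hwi := hw.of_rightWeakLE (rightWeakLE_of_descent hu.1)
    have hwj := hw.of_rightWeakLE (rightWeakLE_of_descent hv.1)
    rcases eq_or_ne i j with rfl | hij
    · exact reflTransGen_commutationMove_append_right (ih hwi u v hu.2 hv.2 hN) _
    have hfar : (i : ℕ) + 1 < j ∨ (j : ℕ) + 1 < i := by
      rw [Ne, Fin.ext_iff] at hij
      by_contra! hnear
      rcases (show (i : ℕ) + 1 = j ∨ (j : ℕ) + 1 = i by omega) with h | h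
      · exact hw (Nat.lt_succ_self (i + 1)) (Nat.lt_succ_self (i + 2)) hu.1
          (by simpa [← h] using hv.1)
      · exact hw (Nat.lt_succ_self (j + 1)) (Nat.lt_succ_self (j + 2)) hv.1
          (by simpa [← h] using hu.1)
    obtain ⟨x, hxj, hxi⟩ := exists_reducedWord_of_far_descents hfar hu.1 hv.1
    have hxN : (x ++ [i]).length = N := by rw [hxi.2, ← hv.2.2, hvN]
    have hux := reflTransGen_commutationMove_append_right (ih hwi u _ hu.2 hxj hN) [i]
    have hxv := reflTransGen_commutationMove_append_right (ih hwj _ v hxi hv.2 hxN) [j]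
    have hmove : CommutationMove (x ++ [j] ++ [i]) (x ++ [i] ++ [j]) :=
      ⟨x, [], j, i, by rw [lt_abs]; omega, by simp, by simp⟩
    exact (hux.tail hmove).trans hxv

lemma exists_rightWeakLE_consecutive_321 (hw : ¬ Avoids321 (letter w)) :
    ∃ v, RightWeakLE v w ∧ ∃ p, letter v (p + 2) < letter v (p + 1) ∧
      letter v (p + 1) < letter v p := by
  induction hN : (inversions w).card using Nat.strong_induction_on generalizing w with
  | _ N ih =>
  by_cases hswap : ∀ p, letter w (p + 1) < letter w p → Avoids321 (swapAt (letter w) p)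
  · exact ⟨w, Relation.ReflTransGen.refl, exists_consecutive_321 hw hswap⟩
  push Not at hswap
  obtain ⟨p, hdesc, hp⟩ := hswap
  obtain ⟨i, rfl⟩ := exists_fin_of_descent hdesc
  rw [← letter_mul_simpleReflection] at hp
  have hcard := card_inversions_of_descent hdesc
  obtain ⟨v, hv, hcons⟩ := ih _ (by omega) hp rfl
  exact ⟨v, hv.trans (rightWeakLE_of_descent hdesc), hcons⟩

lemma exists_reducedWord_braid {i j : Fin (n - 1)} (hij : (j : ℕ) = i + 1)
    (hi : letter w (i + 2) < letter w (i + 1)) (hj : letter w (i + 3) < letter w (i + 2)) :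
    ∃ x, IsReducedWord w (x ++ [i, j, i]) ∧ IsReducedWord w (x ++ [j, i, j]) := by
  have hbraid : w * simpleReflection i * simpleReflection j * simpleReflection i =
      w * simpleReflection j * simpleReflection i * simpleReflection j :=
    eq_of_letter_eq <| by
      simp only [letter_mul_simpleReflection, hij]
      exact swapAt_braid _ _
  obtain ⟨x, hx⟩ :=
    exists_reducedWord (w * simpleReflection i * simpleReflection j * simpleReflection i)
  have hconcat (a b c : Fin (n - 1)) : x ++ [a, b, c] = x ++ [a] ++ [b] ++ [c] := by simp
  have hne : (i : ℕ) + 1 + 1 ≠ i := by omega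
  refine ⟨x, ?_, ?_⟩ <;> rw [hconcat] <;>
    simp only [isReducedWord_concat_iff, letter_mul_simpleReflection, hij, swapAt,
      Function.comp_apply, Equiv.swap_apply_def]
  · simpa [hne] using ⟨hi, hj.trans hi, hj, hx⟩
  · simpa [hne] using ⟨hj, hj.trans hi, hi, hbraid ▸ hx⟩

theorem isFullyCommutative_iff_avoids321 : IsFullyCommutative w ↔ Avoids321 (letter w) := by
  refine ⟨fun hw => ?_, isFullyCommutative_of_avoids321⟩
  by_contra h321
  obtain ⟨v, hvw, p, hdesc', hdesc⟩ := exists_rightWeakLE_consecutive_321 h321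
  obtain ⟨i, rfl⟩ := exists_fin_of_descent hdesc
  obtain ⟨j, hj⟩ := exists_fin_of_descent hdesc'
  obtain ⟨x, hxi, hxj⟩ := exists_reducedWord_braid (show (j : ℕ) = i + 1 by omega) hdesc hdesc'
  obtain ⟨y, hy⟩ := hvw.exists_append
  -- The two words differ in their number of occurrences of `i`.
  have hcount := (perm_of_reflTransGen_commutationMove (hw _ _ (hy _ hxi) (hy _ hxj))).count_eq i
  have hne : j ≠ i := fun h => by rw [h] at hj; omega
  simp [hne] at hcount

end FullyCommutative

/-! ### The first two rows of the insertion tableau -/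

section Rows

variable [LinearOrder α] {R : Finset α} {a x y z : α} {f g : ℕ → α} {p q m : ℕ}

/-- The letter `y` is bumped when `x` is inserted into a row with set of entries `R`. -/
def Bumps (R : Finset α) (x y : α) : Prop := IsLeast {z | z ∈ R ∧ x < z} y

lemma Bumps.mem (h : Bumps R x y) : y ∈ R := h.1.1

lemma Bumps.lt (h : Bumps R x y) : x < y := h.1.2

lemma Bumps.le (h : Bumps R x y) (hz : z ∈ R) (hxz : x < z) : y ≤ z := h.2 ⟨hz, hxz⟩

lemma exists_bumps (hz : z ∈ R) (hxz : x < z) : ∃ y, Bumps R x y := by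
  obtain ⟨y, hy, hmin⟩ := (R.filter (x < ·)).exists_min_image id ⟨z, by simp [hz, hxz]⟩
  simp only [Finset.mem_filter] at hy hmin
  exact ⟨y, hy, hmin⟩

lemma not_bumps_of_forall_le (h : ∀ y ∈ R, y ≤ x) : ¬ Bumps R x y :=
  fun hy => (h y hy.mem).not_gt hy.lt

lemma forall_le_or_exists_bumps (R : Finset α) (x : α) : (∀ y ∈ R, y ≤ x) ∨ ∃ y, Bumps R x y := by
  by_cases! h : ∃ z ∈ R, x < z
  · obtain ⟨z, hz, hxz⟩ := h
    exact Or.inr (exists_bumps hz hxz)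
  · exact Or.inl h

lemma Bumps.insert (h : Bumps R x y) (ha : x < a → y ≤ a) : Bumps (insert a R) x y := by
  refine ⟨⟨Finset.mem_insert_of_mem h.mem, h.lt⟩, fun z ⟨hz, hxz⟩ => ?_⟩
  rcases Finset.mem_insert.1 hz with rfl | hz
  · exact ha hxz
  · exact h.le hz hxz

lemma bumps_insert_self (h : ∀ y ∈ R, y ≤ x) (hxa : x < a) : Bumps (insert a R) x a := by
  refine ⟨⟨Finset.mem_insert_self a R, hxa⟩, fun z ⟨hz, hxz⟩ => ?_⟩
  rcases Finset.mem_insert.1 hz with rfl | hz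
  · exact le_rfl
  · exact absurd hxz (h z hz).not_gt

lemma bumps_insert_iff_of_le (hax : a ≤ x) : Bumps (insert a R) x y ↔ Bumps R x y := by
  have hset : {z | z ∈ insert a R ∧ x < z} = {z | z ∈ R ∧ x < z} := by
    ext z
    simp only [Finset.mem_insert, Set.mem_ofPred_eq, or_and_right, or_iff_right_iff_imp]
    rintro ⟨rfl, hxz⟩
    exact absurd hxz hax.not_gt
  rw [Bumps, Bumps, hset]

open Classical in
/-- Insertion of `x` into a first row with set of entries `S.1`, where `S.2` collects the letters
that are bumped from this row. -/
noncomputable def insertStep (S : Finset α × Finset α) (x : α) : Finset α × Finset α :=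
  (insert x (S.1.filter (¬ Bumps S.1 x ·)), S.1.filter (Bumps S.1 x ·) ∪ S.2)

variable {S : Finset α × Finset α}

lemma mem_insertStep_fst : y ∈ (insertStep S x).1 ↔ y = x ∨ y ∈ S.1 ∧ ¬ Bumps S.1 x y := by
  simp [insertStep]

lemma mem_insertStep_snd : y ∈ (insertStep S x).2 ↔ Bumps S.1 x y ∨ y ∈ S.2 := by
  simp only [insertStep, Finset.mem_union, Finset.mem_filter]
  exact or_congr_left (and_iff_right_of_imp Bumps.mem)

lemma insertStep_of_forall_le (h : ∀ y ∈ S.1, y ≤ x) : insertStep S x = (insert x S.1, S.2) := by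
  ext y
  · simp [mem_insertStep_fst, not_bumps_of_forall_le h]
  · simp [mem_insertStep_snd, not_bumps_of_forall_le h]

lemma insertStep_of_bumps (h : Bumps S.1 x y) :
    insertStep S x = (insert x (S.1.erase y), insert y S.2) := by
  have hiff (z : α) : Bumps S.1 x z ↔ z = y :=
    ⟨fun hz => IsLeast.unique hz h, fun hz => hz ▸ h⟩
  ext z
  · rw [mem_insertStep_fst, hiff, Finset.mem_insert, Finset.mem_erase, and_comm]
  · rw [mem_insertStep_snd, hiff, Finset.mem_insert]

/-- The set of entries of the first row, and the set of letters bumped from it, after the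
insertion of `f 1, …, f p`. -/
noncomputable def rows (f : ℕ → α) : ℕ → Finset α × Finset α
  | 0 => (∅, ∅)
  | p + 1 => insertStep (rows f p) (f (p + 1))

lemma rows_zero (f : ℕ → α) : rows f 0 = (∅, ∅) := rfl

lemma rows_succ (f : ℕ → α) (p : ℕ) : rows f (p + 1) = insertStep (rows f p) (f (p + 1)) := rfl

lemma rows_congr (h : ∀ q ≤ p, f q = g q) : rows f p = rows g p := by
  induction p with
  | zero => rfl
  | succ p ih => rw [rows_succ, rows_succ, ih fun q hq => h q (by omega), h _ le_rfl]

lemma rows_congr_after (hp : rows f p = rows g p) (hpm : p ≤ m) (h : ∀ q, p < q → f q = g q) :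
    rows f m = rows g m := by
  induction m, hpm using Nat.le_induction with
  | base => exact hp
  | succ m hm ih => rw [rows_succ, rows_succ, ih, h _ (by omega)]

lemma mem_rows : y ∈ (rows f p).1 ∨ y ∈ (rows f p).2 ↔ ∃ q, (1 ≤ q ∧ q ≤ p) ∧ f q = y := by
  induction p with
  | zero =>
    simp only [rows_zero, Finset.notMem_empty, or_self, false_iff]
    rintro ⟨q, hq, -⟩
    omega
  | succ p ih =>
    have hsplit : (∃ q, (1 ≤ q ∧ q ≤ p + 1) ∧ f q = y) ↔
        y = f (p + 1) ∨ ∃ q, (1 ≤ q ∧ q ≤ p) ∧ f q = y := by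
      constructor
      · rintro ⟨q, hq, rfl⟩
        rcases eq_or_ne q (p + 1) with rfl | hne
        · exact Or.inl rfl
        · exact Or.inr ⟨q, by omega, rfl⟩
      · rintro (rfl | ⟨q, hq, rfl⟩)
        · exact ⟨p + 1, by omega, rfl⟩
        · exact ⟨q, by omega, rfl⟩
    have hmem : Bumps (rows f p).1 (f (p + 1)) y → y ∈ (rows f p).1 := Bumps.mem
    rw [hsplit, ← ih, rows_succ, mem_insertStep_fst, mem_insertStep_snd]
    tauto

lemma exists_of_mem_rows_fst (hy : y ∈ (rows f p).1) : ∃ q, (1 ≤ q ∧ q ≤ p) ∧ f q = y :=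
  mem_rows.1 (Or.inl hy)

lemma notMem_rows (hf : f.Injective) (h : p < q) : f q ∉ (rows f p).1 ∧ f q ∉ (rows f p).2 := by
  rw [← not_or, mem_rows]
  rintro ⟨r, hr, he⟩
  have := hf he
  omega

lemma rows_disjoint (hf : f.Injective) (hy : y ∈ (rows f p).1) : y ∉ (rows f p).2 := by
  induction p generalizing y with
  | zero => simp [rows_zero]
  | succ p ih =>
    rw [rows_succ, mem_insertStep_fst] at hy
    rw [rows_succ, mem_insertStep_snd, not_or]
    rcases hy with rfl | ⟨hy, hbump⟩
    · exact ⟨fun h => h.lt.false, (notMem_rows hf (Nat.lt_succ_self p)).2⟩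
    · exact ⟨hbump, ih hy⟩

lemma rows_snd_mono (h : p ≤ m) : (rows f p).2 ⊆ (rows f m).2 := by
  induction m, h using Nat.le_induction with
  | base => exact subset_rfl
  | succ m _ ih => exact fun y hy => mem_insertStep_snd.2 (Or.inr (ih hy))

lemma mem_rows_snd_iff : z ∈ (rows f m).2 ↔ ∃ r < m, Bumps (rows f r).1 (f (r + 1)) z := by
  induction m with
  | zero => simp [rows_zero]
  | succ m ih => rw [rows_succ, mem_insertStep_snd, ih, Nat.exists_lt_succ_right, or_comm]

/-- The letters bumped from the first row increase, so that each of them is appended to the end of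
the second row. -/
lemma Avoids321.lt_of_bumps (h321 : Avoids321 f) (hf : f.Injective)
    (hy : Bumps (rows f p).1 (f (p + 1)) y) (hz : z ∈ (rows f p).2) : z < y := by
  have hne : z ≠ y := fun h => rows_disjoint hf hy.mem (h ▸ hz)
  by_contra! hyz
  obtain ⟨r, hr, hbump⟩ := mem_rows_snd_iff.1 hz
  obtain ⟨q, hq, rfl⟩ := exists_of_mem_rows_fst hbump.mem
  obtain ⟨t, ht, rfl⟩ := exists_of_mem_rows_fst hy.mem
  have hlt : f t < f q := hyz.lt_of_ne hne.symm
  rcases lt_or_ge r t with hrt | htr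
  · exact h321 (show q < t by omega) (show t < p + 1 by omega) hlt hy.lt
  · have hmem : f t ∈ (rows f r).1 := (mem_rows.2 ⟨t, ⟨ht.1, htr⟩, rfl⟩).resolve_right
      fun h => rows_disjoint hf hy.mem (rows_snd_mono hr.le h)
    have hle : f t ≤ f (r + 1) := not_lt.1 fun h => (hbump.le hmem h).not_gt hlt
    exact h321 (show q < r + 1 by omega) (show r + 1 < p + 1 by omega) hbump.lt
      (hy.lt.trans_le hle)

end Rows

section InsertionTableau

lemma rowInsert_of_forall_le {x : ℕ} {r : List ℕ} (h : ∀ y ∈ r, y ≤ x) :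
    rowInsert x r = (r ++ [x], none) := by
  induction r with
  | nil => rfl
  | cons a r ih =>
    have ha : ¬ x < a := (h a List.mem_cons_self).not_gt
    rw [rowInsert, if_neg ha, ih fun y hy => h y (List.mem_cons_of_mem a hy)]
    rfl

lemma eq_or_mem_of_mem_rowInsert {x z : ℕ} {r : List ℕ} (h : z ∈ (rowInsert x r).1) :
    z = x ∨ z ∈ r := by
  induction r with
  | nil => exact Or.inl (List.mem_singleton.1 h)
  | cons a r ih =>
    rw [rowInsert] at h
    split_ifs at h <;> simp only [List.mem_cons] at h ⊢ <;> tauto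

lemma pairwise_rowInsert {x : ℕ} {r : List ℕ} (hr : r.Pairwise (· < ·)) (hx : x ∉ r) :
    (rowInsert x r).1.Pairwise (· < ·) := by
  induction r with
  | nil => exact List.pairwise_singleton _ _
  | cons a r ih =>
    rw [List.pairwise_cons] at hr
    rw [List.mem_cons, not_or] at hx
    rw [rowInsert]
    split_ifs with hxa
    · exact List.pairwise_cons.2 ⟨fun z hz => hxa.trans (hr.1 z hz), hr.2⟩
    · refine List.pairwise_cons.2 ⟨fun z hz => ?_, ih hr.2 hx.2⟩
      rcases eq_or_mem_of_mem_rowInsert hz with rfl | hz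
      · omega
      · exact hr.1 z hz

lemma rowInsert_of_bumps {x y : ℕ} {r : List ℕ} (hr : r.Pairwise (· < ·))
    (h : Bumps r.toFinset x y) :
    (rowInsert x r).1.toFinset = insert x (r.toFinset.erase y) ∧ (rowInsert x r).2 = some y := by
  induction r with
  | nil => simpa using h.mem
  | cons a r ih =>
    rw [List.pairwise_cons] at hr
    rw [List.toFinset_cons] at h ⊢
    rw [rowInsert]
    split_ifs with hxa
    · have hle : y ≤ a := h.le (Finset.mem_insert_self _ _) hxa
      obtain rfl : y = a := (Finset.mem_insert.1 h.mem).resolve_right fun hy =>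
        hle.not_gt (hr.1 y (List.mem_toFinset.1 hy))
      have hy : y ∉ r.toFinset := fun hy => (hr.1 y (List.mem_toFinset.1 hy)).false
      rw [Finset.erase_insert hy, List.toFinset_cons]
      exact ⟨rfl, rfl⟩
    · rw [bumps_insert_iff_of_le (not_lt.1 hxa)] at h
      obtain ⟨hrow, hbump⟩ := ih hr.2 h
      have hne : a ≠ y := fun hay => hxa (hay ▸ h.lt)
      rw [List.toFinset_cons, hrow, Finset.erase_insert_of_ne hne, Finset.insert_comm]
      exact ⟨rfl, hbump⟩

lemma tableauInsert_getD_zero (x : ℕ) (T : List (List ℕ)) :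
    (tableauInsert x T).getD 0 [] = (rowInsert x (T.getD 0 [])).1 := by
  cases T with
  | nil => rfl
  | cons r T =>
    rw [tableauInsert]
    rcases h : rowInsert x r with ⟨r', _ | y⟩ <;> simp [h]

lemma tableauInsert_getD_one (x : ℕ) (T : List (List ℕ)) :
    (tableauInsert x T).getD 1 [] =
      (rowInsert x (T.getD 0 [])).2.elim (T.getD 1 []) fun y => (rowInsert y (T.getD 1 [])).1 := by
  cases T with
  | nil => rfl
  | cons r T =>
    rw [tableauInsert]
    rcases h : rowInsert x r with ⟨r', _ | y⟩
    · simp [h]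
    · simpa [h] using tableauInsert_getD_zero y T

/-- The insertion tableau of `f 1, …, f p`. -/
def tableauOf (f : ℕ → ℕ) (p : ℕ) : List (List ℕ) :=
  ((List.range p).map fun i => f (i + 1)).foldl (fun T x => tableauInsert x T) []

lemma tableauOf_succ (f : ℕ → ℕ) (p : ℕ) :
    tableauOf f (p + 1) = tableauInsert (f (p + 1)) (tableauOf f p) := by
  simp [tableauOf, List.range_succ]

lemma insertionTableau_eq (w : Equiv.Perm (Fin n)) :
    insertionTableau w = tableauOf (letter w) n := by
  have hone : oneLine w = (List.range n).map fun i => letter w (i + 1) := by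
    refine List.ext_getElem (by simp [oneLine]) fun i hi _ => ?_
    rw [oneLine, List.length_ofFn] at hi
    simp [oneLine, letter_of_mem w (show 1 ≤ i + 1 ∧ i + 1 ≤ n by omega)]
  rw [insertionTableau, hone, tableauOf]

variable {f : ℕ → ℕ}

lemma tableauOf_getD_zero (hf : f.Injective) (p : ℕ) :
    ((tableauOf f p).getD 0 []).Pairwise (· < ·) ∧
      ((tableauOf f p).getD 0 []).toFinset = (rows f p).1 := by
  induction p with
  | zero => simp [tableauOf, rows_zero]
  | succ p ih =>
    obtain ⟨hsorted, hrow⟩ := ih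
    rw [tableauOf_succ, tableauInsert_getD_zero, rows_succ]
    refine ⟨pairwise_rowInsert hsorted fun hx => ?_, ?_⟩
    · rw [← List.mem_toFinset, hrow] at hx
      exact (notMem_rows hf (Nat.lt_succ_self p)).1 hx
    · rcases forall_le_or_exists_bumps (rows f p).1 (f (p + 1)) with h | ⟨y, hy⟩
      · rw [insertStep_of_forall_le h, ← hrow, rowInsert_of_forall_le]
        · ext z
          simp
        · exact fun y hy => h y (hrow ▸ List.mem_toFinset.2 hy)
      · rw [insertStep_of_bumps hy, ← hrow, (rowInsert_of_bumps hsorted (hrow ▸ hy)).1]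

lemma tableauOf_getD_one (hf : f.Injective) (h321 : Avoids321 f) (p : ℕ) :
    ((tableauOf f p).getD 1 []).toFinset = (rows f p).2 := by
  induction p with
  | zero => simp [tableauOf, rows_zero]
  | succ p ih =>
    obtain ⟨hsorted, hrow⟩ := tableauOf_getD_zero hf p
    rw [tableauOf_succ, tableauInsert_getD_one, rows_succ]
    rcases forall_le_or_exists_bumps (rows f p).1 (f (p + 1)) with h | ⟨y, hy⟩
    · rw [insertStep_of_forall_le h, rowInsert_of_forall_le]
      · exact ih
      · exact fun y hy => h y (hrow ▸ List.mem_toFinset.2 hy)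
    · rw [insertStep_of_bumps hy, (rowInsert_of_bumps hsorted (hrow ▸ hy)).2, Option.elim_some,
        rowInsert_of_forall_le, ← ih]
      · ext z
        simp
      · exact fun z hz => (h321.lt_of_bumps hf hy (ih ▸ List.mem_toFinset.2 hz)).le

/-- The set of letters bumped from the first row during the insertion of `f 1, …, f p`, as
integers. -/
def bumped (f : ℕ → ℕ) (p : ℕ) : Set ℤ := ((↑) : ℕ → ℤ) '' (rows f p).2

variable {w : Equiv.Perm (Fin n)}

theorem rowTwo_insertionTableau (h321 : Avoids321 (letter w)) :
    rowTwo (insertionTableau w) = bumped (letter w) n := by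
  ext z
  simp only [rowTwo, bumped, insertionTableau_eq, ← tableauOf_getD_one (letter_injective w) h321,
    Set.mem_image, Set.mem_ofPred_eq, List.coe_toFinset, eq_comm]

theorem mem_crowdedFC_iff :
    w ∈ crowdedFC n ↔ Avoids321 (letter w) ∧ IsCrowded (bumped (letter w) n) := by
  rw [crowdedFC, Set.mem_ofPred_eq, isFullyCommutative_iff_avoids321]
  exact and_congr_right fun h321 => by rw [rowTwo_insertionTableau h321]

end InsertionTableau

/-! ### Undoing a descent -/

section UndoDescent

variable [LinearOrder α] {S : Finset α × Finset α} {T : Finset α} {a b c x y : α} {f : ℕ → α}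
  {p m : ℕ}

/-- The Knuth relation `bac ∼ bca`, for `a < b < c`. -/
lemma insertStep_comm_of_bumps (hmax : ∀ y ∈ S.1, y < c) (hy : Bumps S.1 a y) :
    insertStep (insertStep S a) c = insertStep (insertStep S c) a := by
  have hyc : y < c := hmax y hy.mem
  have hle : ∀ z ∈ insert a (S.1.erase y), z ≤ c := by
    simpa only [Finset.forall_mem_insert] using
      ⟨(hy.lt.trans hyc).le, fun z hz => (hmax z (Finset.mem_of_mem_erase hz)).le⟩
  rw [insertStep_of_bumps hy, insertStep_of_forall_le hle,
    insertStep_of_forall_le fun z hz => (hmax z hz).le,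
    insertStep_of_bumps (hy.insert fun _ => hyc.le), Finset.erase_insert_of_ne hyc.ne',
    Finset.insert_comm]

lemma insertStep_insertStep_of_lt (hmax : ∀ y ∈ S.1, y < a) (hac : a < c) :
    insertStep (insertStep S a) c = (insert c (insert a S.1), S.2) := by
  rw [insertStep_of_forall_le fun y hy => (hmax y hy).le, insertStep_of_forall_le]
  simpa only [Finset.forall_mem_insert] using
    ⟨hac.le, fun y hy => ((hmax y hy).trans hac).le⟩

lemma insertStep_insertStep_of_gt (hmax : ∀ y ∈ S.1, y < a) (hac : a < c) :
    insertStep (insertStep S c) a = (insert a S.1, insert c S.2) := by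
  have hc : c ∉ S.1 := fun h => (hac.trans (hmax c h)).false
  rw [insertStep_of_forall_le fun y hy => ((hmax y hy).trans hac).le,
    insertStep_of_bumps (bumps_insert_self (fun y hy => (hmax y hy).le) hac),
    Finset.erase_insert hc]

/-- The Knuth relation `acb ∼ cab`, for `a < b < c`. -/
lemma insertStep_comm_of_between (hmax : ∀ y ∈ S.1, y < a) (hab : a < b) (hbc : b < c) :
    insertStep (insertStep (insertStep S a) c) b =
      insertStep (insertStep (insertStep S c) a) b := by
  have hle : ∀ y ∈ insert a S.1, y ≤ b := by
    simpa only [Finset.forall_mem_insert] using ⟨hab.le, fun y hy => ((hmax y hy).trans hab).le⟩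
  have hc : c ∉ insert a S.1 := fun h => (hle c h).not_gt hbc
  rw [insertStep_insertStep_of_lt hmax (hab.trans hbc),
    insertStep_insertStep_of_gt hmax (hab.trans hbc),
    insertStep_of_bumps (bumps_insert_self hle hbc), Finset.erase_insert hc,
    insertStep_of_forall_le hle]

lemma rows_swapAt_of_le (f : ℕ → α) (p : ℕ) : rows (swapAt f (p + 1)) p = rows f p :=
  rows_congr fun q hq => swapAt_of_ne f (by omega) (by omega)

lemma rows_swapAt_add_two (f : ℕ → α) (p : ℕ) :
    rows (swapAt f (p + 1)) (p + 2) =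
      insertStep (insertStep (rows f p) (f (p + 2))) (f (p + 1)) := by
  rw [rows_succ, rows_succ, rows_swapAt_of_le, swapAt_left, swapAt_right]

lemma rows_swapAt_eq_of_bumps (hmax : ∀ y ∈ (rows f p).1, y < f (p + 1))
    (hy : Bumps (rows f p).1 (f (p + 2)) y) :
    rows (swapAt f (p + 1)) (p + 2) = rows f (p + 2) := by
  rw [rows_swapAt_add_two]
  exact insertStep_comm_of_bumps hmax hy

lemma rows_swapAt_eq_of_between (hmax : ∀ y ∈ (rows f p).1, y < f (p + 2))
    (hlt : f (p + 2) < f (p + 3)) (hlt' : f (p + 3) < f (p + 1)) :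
    rows (swapAt f (p + 1)) (p + 3) = rows f (p + 3) := by
  rw [rows_succ, rows_swapAt_add_two, swapAt_of_ne f (by omega) (by omega)]
  exact insertStep_comm_of_between hmax hlt hlt'

lemma insertStep_insert_fst_of_lt (hax : a < x) :
    (insertStep (insert a S.1, T) x).1 = insert a (insertStep S x).1 := by
  ext y
  have hbump : Bumps S.1 x y → y ≠ a := fun h hya => (hax.trans (hya ▸ h.lt)).false
  simp only [mem_insertStep_fst, Finset.mem_insert, bumps_insert_iff_of_le hax.le]
  tauto

lemma insertStep_snd_subset_insert_of_lt (hax : a < x) (h : S.2 ⊆ insert a T) :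
    (insertStep S x).2 ⊆ insert a (insertStep (insert a S.1, T) x).2 := by
  intro y
  have hy := @h y
  simp only [mem_insertStep_snd, Finset.mem_insert, bumps_insert_iff_of_le hax.le] at hy ⊢
  tauto

lemma rows_snd_subset_swapAt (hmax : ∀ y ∈ (rows f p).1, y < f (p + 2))
    (hdesc : f (p + 2) < f (p + 1)) (hlater : ∀ q, p + 2 < q → f (p + 1) < f q) (hm : p + 2 ≤ m) :
    (rows f m).2 ⊆ insert (f (p + 1)) (rows (swapAt f (p + 1)) m).2 := by
  suffices h : (rows (swapAt f (p + 1)) m).1 = insert (f (p + 1)) (rows f m).1 ∧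
      (rows f m).2 ⊆ insert (f (p + 1)) (rows (swapAt f (p + 1)) m).2 from h.2
  induction m, hm using Nat.le_induction with
  | base =>
    have hrows : rows f (p + 2) =
        (insert (f (p + 2)) (rows f p).1, insert (f (p + 1)) (rows f p).2) :=
      insertStep_insertStep_of_gt hmax hdesc
    rw [rows_swapAt_add_two, insertStep_insertStep_of_lt hmax hdesc, hrows]
    exact ⟨rfl, subset_rfl⟩
  | succ m hm ih =>
    have hlt := hlater (m + 1) (by omega)
    rw [rows_succ, rows_succ, swapAt_of_ne f (by omega) (by omega),
      ← Prod.mk.eta (p := rows (swapAt f (p + 1)) m), ih.1]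
    exact ⟨insertStep_insert_fst_of_lt hlt, insertStep_snd_subset_insert_of_lt hlt ih.2⟩

/-- The letters of `f 1, …, f p` that are the larger one of a descent among these letters. -/
def descentTops (f : ℕ → α) (p : ℕ) : Finset α :=
  ((Finset.Ico 1 p).filter fun q => f (q + 1) < f q).image f

lemma mem_descentTops : x ∈ descentTops f p ↔ ∃ q, (1 ≤ q ∧ q < p) ∧ f (q + 1) < f q ∧ f q = x := by
  simp [descentTops, and_assoc]

lemma descentTops_add_two (f : ℕ → α) (p : ℕ) : descentTops f (p + 2) =
    if f (p + 2) < f (p + 1) then insert (f (p + 1)) (descentTops f (p + 1))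
    else descentTops f (p + 1) := by
  have hIco : Finset.Ico 1 (p + 2) = insert (p + 1) (Finset.Ico 1 (p + 1)) :=
    (Finset.insert_Ico_right_eq_Ico_add_one (by omega)).symm
  rw [descentTops, hIco, Finset.filter_insert]
  split_ifs
  · rw [Finset.image_insert, descentTops]
  · rfl

lemma rows_snd_eq_descentTops (hf : f.Injective)
    (hmax : ∀ p, f p < f (p + 1) → ∀ q ≤ p, f q < f (p + 1))
    (hrow : ∀ p, f (p + 2) < f (p + 1) → (rows f p).2 = descentTops f p →
      ∀ y ∈ (rows f p).1, y < f (p + 2)) (p : ℕ) :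
    (rows f p).2 = descentTops f p := by
  have hasc (p : ℕ) (h : f p < f (p + 1)) : (rows f (p + 1)).2 = (rows f p).2 := by
    rw [rows_succ, insertStep_of_forall_le fun y hy => ?_]
    obtain ⟨q, hq, rfl⟩ := exists_of_mem_rows_fst hy
    exact (hmax p h q hq.2).le
  induction p using Nat.twoStepInduction with
  | zero => simp [rows_zero, descentTops]
  | one => simp [rows_succ, rows_zero, insertStep_of_forall_le, descentTops]
  | more p ih ih' =>
    rw [descentTops_add_two]
    split_ifs with h
    · have hbelow := hrow p h ih
      have hrow_eq : (rows f (p + 1)).2 = (rows f p).2 := by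
        rw [rows_succ, insertStep_of_forall_le fun y hy => ((hbelow y hy).trans h).le]
      rw [← ih', hrow_eq]
      exact congrArg Prod.snd (insertStep_insertStep_of_gt hbelow h)
    · rw [← ih']
      exact hasc _ ((not_lt.1 h).lt_of_ne (hf.ne (by omega)))

end UndoDescent

/-! ### Crowded sets -/

section Crowded

variable {L M : Set ℤ} {a : ℕ → ℤ} {k : ℕ}

lemma IsUncrowded.mono (hM : IsUncrowded M) (h : L ⊆ M) : IsUncrowded L := by
  intro x y hx
  refine le_trans ?_ (hM x y hx)
  exact_mod_cast Set.ncard_le_ncard (Set.inter_subset_inter_right _ h)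
    ((Set.finite_Icc _ _).inter_of_left _)

lemma isCrowded_iff :
    IsCrowded L ↔ ∃ x y : ℤ, 0 < x ∧ x + 2 ≤ ((Set.Icc y (y + 2 * x) ∩ L).ncard : ℤ) := by
  simp only [IsCrowded, IsUncrowded, not_forall, not_le, exists_prop, Int.lt_iff_add_one_le,
    add_assoc, one_add_one_eq_two]

lemma IsUncrowded.two_mul_ncard_Icc_inter_le (hL : IsUncrowded L) {y z : ℤ} (hyz : y ≤ z) :
    2 * ((Set.Icc y z ∩ L).ncard : ℤ) ≤ z - y + 3 := by
  rcases hyz.eq_or_lt with rfl | hlt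
  · have hle := Set.ncard_le_ncard (Set.inter_subset_left (s := Set.Icc y y) (t := L))
    rw [Set.Icc_self, Set.ncard_singleton] at hle
    rw [Set.Icc_self]
    omega
  · have hsub : Set.Icc y z ∩ L ⊆ Set.Icc y (y + 2 * ((z - y + 1) / 2)) ∩ L :=
      Set.inter_subset_inter_left _ (Set.Icc_subset_Icc_right (by omega))
    have hle := Set.ncard_le_ncard hsub ((Set.finite_Icc _ _).inter_of_left _)
    have := hL ((z - y + 1) / 2) y (by omega)
    omega

lemma isCrowded_image_of_le_mul (ha : StrictMonoOn a (Set.Iio k)) {i j : ℕ} (hij : i ≤ j)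
    (hj : j < k) (h : a j - a i + 2 ≤ 2 * ((j : ℤ) - i)) : IsCrowded (a '' Set.Iio k) := by
  intro hL
  have hmono : StrictMonoOn a (Set.Icc i j) := ha.mono fun t ht => ht.2.trans_lt hj
  have hsub : a '' Set.Icc i j ⊆ Set.Icc (a i) (a j) ∩ a '' Set.Iio k := by
    rintro _ ⟨t, ht, rfl⟩
    exact ⟨⟨hmono.monotoneOn ⟨le_rfl, hij⟩ ht ht.1, hmono.monotoneOn ht ⟨hij, le_rfl⟩ ht.2⟩,
      t, ht.2.trans_lt hj, rfl⟩
  have hcard := Set.ncard_le_ncard hsub ((Set.finite_Icc _ _).inter_of_left _)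
  rw [hmono.injOn.ncard_image, ← Finset.coe_Icc, Set.ncard_coe_finset, Nat.card_Icc] at hcard
  have := hL.two_mul_ncard_Icc_inter_le (hmono.monotoneOn ⟨le_rfl, hij⟩ ⟨hij, le_rfl⟩ hij)
  omega

lemma isUncrowded_image_of_mul_le
    (h : ∀ i j, i < j → j < k → 2 * ((j : ℤ) - i) ≤ a j - a i + 1) :
    IsUncrowded (a '' Set.Iio k) := by
  intro x y hx
  set S := (Finset.range k).filter fun i => a i ∈ Set.Icc y (y + 2 * x) with hS
  have himage : Set.Icc y (y + 2 * x) ∩ a '' Set.Iio k = a '' S := by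
    rw [Set.inter_comm, ← Set.image_inter_preimage, hS, Finset.coe_filter]
    simp only [Finset.mem_range]
    rfl
  have hle : (Set.Icc y (y + 2 * x) ∩ a '' Set.Iio k).ncard ≤ S.card := by
    rw [himage, ← Set.ncard_coe_finset]
    exact Set.ncard_image_le S.finite_toSet
  rcases S.eq_empty_or_nonempty with hempty | hne
  · rw [hempty, Finset.card_empty] at hle
    omega
  obtain ⟨i, hi, hmin⟩ := S.exists_min_image id hne
  obtain ⟨j, hj, hmax⟩ := S.exists_max_image id hne
  have hcard := Finset.card_le_card (fun t ht => Finset.mem_Icc.2 ⟨hmin t ht, hmax t ht⟩ :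
    S ⊆ Finset.Icc i j)
  have hij : i ≤ j := hmin j hj
  simp only [hS, Finset.mem_filter, Finset.mem_range, Set.mem_Icc] at hi hj
  rw [Nat.card_Icc] at hcard
  rcases hij.eq_or_lt with rfl | hlt
  · omega
  · have := h i j hlt hj.1
    omega

/-- Every interval witnessing that `L` is crowded contains both `a` and `b`. -/
lemma IsCrowded.sub_lt_two_mul_ncard (hL : IsCrowded L) {a b : ℤ} (hab : a < b)
    (ha : IsUncrowded (L \ {a})) (hb : IsUncrowded (L \ {b})) (hub : b ∈ upperBounds L) :
    b - a < 2 * ((Set.Ioc a b ∩ L).ncard : ℤ) := by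
  obtain ⟨x, y, hx, hcard⟩ := isCrowded_iff.1 hL
  have hmem (c : ℤ) (hc : IsUncrowded (L \ {c})) : c ∈ Set.Icc y (y + 2 * x) := by
    by_contra hcI
    have hsub : Set.Icc y (y + 2 * x) ∩ L ⊆ Set.Icc y (y + 2 * x) ∩ (L \ {c}) :=
      fun z hz => ⟨hz.1, hz.2, fun hzc => hcI (hzc ▸ hz.1)⟩
    have := Set.ncard_le_ncard hsub ((Set.finite_Icc _ _).inter_of_left _)
    have := hc x y hx
    omega
  have hsplit : Set.Icc y (y + 2 * x) ∩ L ⊆ (Set.Icc y a ∩ (L \ {b})) ∪ (Set.Ioc a b ∩ L) := by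
    intro z hz
    rcases le_or_gt z a with hza | haz
    · exact Or.inl ⟨⟨hz.1.1, hza⟩, hz.2, (hza.trans_lt hab).ne⟩
    · exact Or.inr ⟨⟨haz, hub hz.2⟩, hz.2⟩
  have hle := (Set.ncard_le_ncard hsplit (((Set.finite_Icc _ _).inter_of_left _).union
    ((Set.finite_Ioc _ _).inter_of_left _))).trans (Set.ncard_union_le _ _)
  have := hb.two_mul_ncard_Icc_inter_le (hmem a ha).1
  have := (hmem b hb).2
  omega

end Crowded

/-! ### Blocks of overlapping descents -/

section Block

variable [LinearOrder α] {f : ℕ → α} {d k p q i j : ℕ}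

lemma lt_of_ascent (hf : f.Injective) (h : ∀ p, f (p + 1) < f p → f p < f (p + 2))
    (hp : f p < f (p + 1)) (hq : q ≤ p) : f q < f (p + 1) := by
  induction p using Nat.strong_induction_on generalizing q with
  | _ p ih =>
  rcases hq.eq_or_lt with rfl | hq
  · exact hp
  obtain ⟨p, rfl⟩ := Nat.exists_eq_succ_of_ne_zero (show p ≠ 0 by omega)
  rcases lt_or_gt_of_ne (hf.ne (show p ≠ p + 1 by omega)) with hasc | hdesc
  · exact (ih p (by omega) hasc (by omega)).trans hp
  rcases (show q ≤ p by omega).eq_or_lt with rfl | hqp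
  · exact h q hdesc
  obtain ⟨p, rfl⟩ := Nat.exists_eq_succ_of_ne_zero (show p ≠ 0 by omega)
  rcases lt_or_gt_of_ne (hf.ne (show p ≠ p + 1 by omega)) with hasc' | hdesc'
  · exact (ih p (by omega) hasc' (by omega)).trans (h (p + 1) hdesc)
  · exact ((h p hdesc').trans (hdesc.trans hdesc')).false.elim

/-- The inversions of `f` lie between a *top* position `d + 2 * i` and a *bottom* position
`d + 2 * j + 1` with `i ≤ j ≤ k`, and the pairs with `j = i` or `j = i + 1` are inversions.
This is the shape of the minimal crowded permutations: their descents are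
`d, d + 2, …, d + 2 * k`. -/
structure IsBlock (f : ℕ → α) (d k : ℕ) : Prop where
  injective : f.Injective
  exists_of_inversion : ∀ ⦃p q⦄, p < q → f q < f p →
    ∃ i j, i ≤ j ∧ j ≤ k ∧ p = d + 2 * i ∧ q = d + 2 * j + 1
  descent : ∀ ⦃i⦄, i ≤ k → f (d + 2 * i + 1) < f (d + 2 * i)
  cross : ∀ ⦃i⦄, i < k → f (d + 2 * i + 3) < f (d + 2 * i)

/-- A block without inversions between a top and the bottom three steps later. -/
structure IsThinBlock (f : ℕ → α) (d k : ℕ) : Prop extends IsBlock f d k where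
  top_lt_bottom : ∀ ⦃i⦄, i + 3 ≤ k → f (d + 2 * i) < f (d + 2 * (i + 3) + 1)

namespace IsBlock

lemma of_descent_iff (hf : f.Injective) (hdesc : ∀ p, f (p + 1) < f p ↔ ∃ i ≤ k, p = d + 2 * i)
    (hthird : ∀ p, f (p + 1) < f p → f p < f (p + 2))
    (hcross : ∀ i < k, f (d + 2 * i + 3) < f (d + 2 * i))
    (htop : ∀ p q, f (p + 1) < f p → q < p → f (p + 1) < f q → f (q + 1) < f q) :
    IsBlock f d k where
  injective := hf
  exists_of_inversion p q hpq hlt := by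
    obtain ⟨q, rfl⟩ := Nat.exists_eq_succ_of_ne_zero (show q ≠ 0 by omega)
    have hq : f (q + 1) < f q := by
      by_contra hq
      have hasc := (not_lt.1 hq).lt_of_ne (hf.ne (by omega))
      exact hlt.not_gt (lt_of_ascent hf hthird hasc (by omega))
    have hp : f (p + 1) < f p := by
      rcases (show p ≤ q by omega).eq_or_lt with rfl | hp
      · exact hq
      · exact htop q p hq hp hlt
    obtain ⟨i, _, rfl⟩ := (hdesc p).1 hp
    obtain ⟨j, hj, rfl⟩ := (hdesc q).1 hq
    exact ⟨i, j, by omega, hj, rfl, rfl⟩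
  descent i hi := (hdesc _).2 ⟨i, hi, rfl⟩
  cross := hcross

variable (h : IsBlock f d k)
include h

lemma descent_iff : f (p + 1) < f p ↔ ∃ i ≤ k, p = d + 2 * i := by
  refine ⟨fun hp => ?_, ?_⟩
  · obtain ⟨i, j, hij, hj, rfl, -⟩ := h.exists_of_inversion (Nat.lt_succ_self p) hp
    exact ⟨i, hij.trans hj, rfl⟩
  · rintro ⟨i, hi, rfl⟩
    exact h.descent hi

lemma lt_of_forall_ne_bottom (hq : ∀ j ≤ k, q ≠ d + 2 * j + 1) (hpq : p < q) : f p < f q := by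
  by_contra! hqp
  obtain ⟨-, j, -, hjk, -, hj⟩ :=
    h.exists_of_inversion hpq (hqp.lt_of_ne (h.injective.ne hpq.ne'))
  exact hq j hjk hj

lemma lt_of_forall_ne_top (hp : ∀ i, p ≠ d + 2 * i) (hpq : p < q) : f p < f q := by
  by_contra! hqp
  obtain ⟨i, -, -, -, hi, -⟩ := h.exists_of_inversion hpq (hqp.lt_of_ne (h.injective.ne hpq.ne'))
  exact hp i hi

lemma top_strictMono : StrictMono fun i => f (d + 2 * i) :=
  fun _ _ hij => h.lt_of_forall_ne_bottom (fun _ _ => by omega) (by omega)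

lemma bottom_strictMono : StrictMono fun j => f (d + 2 * j + 1) :=
  fun _ _ hij => h.lt_of_forall_ne_top (fun _ => by omega) (by omega)

lemma lt_of_ascent (hp : f p < f (p + 1)) (hq : q ≤ p) : f q < f (p + 1) := by
  by_contra! hqp
  obtain ⟨-, j, -, hj, -, hpj⟩ :=
    h.exists_of_inversion (by omega) (hqp.lt_of_ne (h.injective.ne (by omega)))
  obtain rfl : p = d + 2 * j := by omega
  exact hp.not_gt (h.descent hj)

lemma avoids321 : Avoids321 f := by
  intro p q r hpq hqr hlt hlt'
  obtain ⟨-, j, -, -, -, hq⟩ := h.exists_of_inversion hpq hlt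
  obtain ⟨i, -, -, -, hq', -⟩ := h.exists_of_inversion hqr hlt'
  omega

lemma rows_snd_eq_descentTops (p : ℕ) : (rows f p).2 = descentTops f p := by
  refine FCPerm.rows_snd_eq_descentTops h.injective (fun p hp q hq => h.lt_of_ascent hp hq)
    (fun p _ hrows y hy => ?_) p
  obtain ⟨q, hq, rfl⟩ := exists_of_mem_rows_fst hy
  by_contra! hlt
  obtain ⟨i, j, _, hj, rfl, hpj⟩ := h.exists_of_inversion (show q < p + 2 by omega)
    (hlt.lt_of_ne (h.injective.ne (by omega)))
  refine rows_disjoint h.injective hy (hrows ▸ mem_descentTops.2 ⟨_, ?_, h.descent ?_, rfl⟩) <;>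
  omega

end IsBlock

lemma IsThinBlock.lt_add_three (h : IsThinBlock f d k) (hj : j ≤ k)
    (hlt : f (d + 2 * j + 1) < f (d + 2 * i)) : j < i + 3 := by
  by_contra! hij
  exact ((h.top_lt_bottom (hij.trans hj)).trans_le (h.bottom_strictMono.monotone hij)).not_gt hlt

end Block

section Counting

variable {f : ℕ → ℕ} {d k i m : ℕ} {S : Finset ℕ}

lemma card_le_of_forall_lt (hf : f.Injective) (hS : ∀ q ∈ S, f q < m) : S.card ≤ m :=
  (Finset.card_le_card_of_injOn f (fun q hq => Finset.mem_range.2 (hS q hq)) hf.injOn).trans_eq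
    (Finset.card_range m)

lemma le_card_of_forall_mem (hf : f.Surjective) (hS : ∀ q, f q < m → q ∈ S) : m ≤ S.card := by
  have hsurj : Set.SurjOn f S (Finset.range m : Finset ℕ) := fun z hz => by
    obtain ⟨q, rfl⟩ := hf z
    exact ⟨q, hS q (by simpa using hz), rfl⟩
  simpa using Finset.card_le_card_of_surjOn f hsurj

lemma apply_eq_self_of_cut (hf : f.Bijective) (hbelow : ∀ q < i, f q < f i)
    (habove : ∀ q, i < q → f i < f q) : f i = i := by
  refine le_antisymm ?_ ?_
  · refine (le_card_of_forall_mem (S := Finset.range i) hf.2 fun q hq => ?_).trans_eq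
      (Finset.card_range i)
    rw [Finset.mem_range]
    by_contra! hiq
    rcases hiq.eq_or_lt with rfl | hlt
    · exact hq.false
    · exact hq.not_gt (habove q hlt)
  · exact (Finset.card_range i).symm.trans_le
      (card_le_of_forall_lt hf.1 fun q hq => hbelow q (Finset.mem_range.1 hq))

namespace IsBlock

variable (h : IsBlock f d k)
include h

/-- The top exceeds all letters before it and the bottoms from `i` to `i + m`. -/
lemma le_top (hlt : f (d + 2 * (i + m) + 1) < f (d + 2 * i)) :
    d + 2 * i + m + 1 ≤ f (d + 2 * i) := by
  set bottoms := (Finset.range (m + 1)).image fun j => d + 2 * (i + j) + 1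
  have hdisj : Disjoint (Finset.range (d + 2 * i)) bottoms := by
    simp only [bottoms, Finset.disjoint_left, Finset.mem_range, Finset.mem_image]
    omega
  have hcard : bottoms.card = m + 1 := by
    rw [Finset.card_image_of_injective _ fun a b hab => by simpa using hab, Finset.card_range]
  have hle : (Finset.range (d + 2 * i) ∪ bottoms).card ≤ f (d + 2 * i) := by
    refine card_le_of_forall_lt h.injective fun q hq => ?_
    simp only [bottoms, Finset.mem_union, Finset.mem_image, Finset.mem_range] at hq
    rcases hq with hq | ⟨j, hj, rfl⟩
    · exact h.lt_of_forall_ne_bottom (fun _ _ => by omega) hq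
    · exact (h.bottom_strictMono.monotone (show i + j ≤ i + m by omega)).trans_lt hlt
  rw [Finset.card_union_of_disjoint hdisj, Finset.card_range] at hle
  omega

lemma top_le (hf : f.Surjective)
    (hlt : i + m ≤ k → f (d + 2 * i) < f (d + 2 * (i + m) + 1)) :
    f (d + 2 * i) ≤ d + 2 * i + m := by
  set bottoms := (Finset.range m).image fun j => d + 2 * (i + j) + 1
  have hcard : bottoms.card ≤ m := Finset.card_image_le.trans_eq (Finset.card_range m)
  have hle : f (d + 2 * i) ≤ (Finset.range (d + 2 * i) ∪ bottoms).card := by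
    refine le_card_of_forall_mem hf fun q hq => ?_
    simp only [bottoms, Finset.mem_union, Finset.mem_image, Finset.mem_range]
    rcases lt_trichotomy q (d + 2 * i) with hqi | rfl | hqi
    · exact Or.inl hqi
    · exact absurd hq (lt_irrefl _)
    obtain ⟨i', j, hij, hj, hi, rfl⟩ := h.exists_of_inversion hqi hq
    refine Or.inr ⟨j - i, ?_, by omega⟩
    by_contra! hm
    have hbottom : f (d + 2 * (i + m) + 1) ≤ f (d + 2 * j + 1) :=
      h.bottom_strictMono.monotone (by omega)
    exact ((hlt (by omega)).trans_le hbottom).not_gt hq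
  have := Finset.card_union_le (Finset.range (d + 2 * i)) bottoms
  rw [Finset.card_range] at this
  omega

end IsBlock

/-- The letters of `f` in the positions `d, d + 2, …, d + 2 * (k - 1)`, as integers. -/
def tops (f : ℕ → ℕ) (d k : ℕ) : Set ℤ := (fun i => (f (d + 2 * i) : ℤ)) '' Set.Iio k

lemma tops_succ_eq (f : ℕ → ℕ) (d k : ℕ) :
    tops f d (k + 1) = {z : ℤ | ∃ i : ℕ, i ≤ k ∧ z = (f (d + 2 * i) : ℤ)} := by
  ext z
  simp only [tops, Set.mem_image, Set.mem_Iio, Set.mem_ofPred_eq, Nat.lt_succ_iff, eq_comm]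

lemma IsBlock.isUncrowded_tops (h : IsBlock f d k) (hf : f.Surjective)
    (hlt : ∀ i, i + 2 ≤ k → f (d + 2 * i) < f (d + 2 * (i + 2) + 1)) :
    IsUncrowded (tops f d (k + 1)) := by
  refine isUncrowded_image_of_mul_le fun i j _ hj => ?_
  have := h.top_le hf (hlt i)
  have := h.le_top (i := j) (m := 0) (h.descent (by omega))
  omega

lemma IsThinBlock.isUncrowded_tops (h : IsThinBlock f d k) (hf : f.Surjective) :
    IsUncrowded (tops f d k) := by
  refine isUncrowded_image_of_mul_le fun i j _ hj => ?_
  have := h.top_le hf (h.top_lt_bottom (i := i))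
  have := h.le_top (i := j) (m := 1) (h.cross hj)
  omega

lemma IsBlock.isCrowded_tops (h : IsBlock f d k) (hf : f.Surjective) {i : ℕ} (hi : i + 3 ≤ k)
    (hlt : f (d + 2 * (i + 3) + 1) < f (d + 2 * i)) : IsCrowded (tops f d k) := by
  have hmono : StrictMono fun j => (f (d + 2 * j) : ℤ) :=
    fun _ _ hij => Int.ofNat_lt.2 (h.top_strictMono hij)
  refine isCrowded_image_of_le_mul (hmono.strictMonoOn _) (i := i) (j := k - 1) (by omega)
    (by omega) ?_
  have := h.le_top hlt
  have := h.top_le (i := k - 1) (m := 2) hf fun _ => by omega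
  omega

end Counting

section BlockPermutation

variable {w : Equiv.Perm (Fin n)} {d k : ℕ} (h : IsBlock (letter w) d k)
include h

namespace IsBlock

lemma bounds : 1 ≤ d ∧ d + 2 * k + 1 ≤ n :=
  ⟨(bounds_of_inversion (Nat.lt_succ_self _) (h.descent (Nat.zero_le k))).1,
    (bounds_of_inversion (Nat.lt_succ_self _) (h.descent le_rfl)).2⟩

lemma descents_eq : descents w = {j | ∃ i : ℕ, i ≤ k ∧ j = d + 2 * i} := by
  ext p
  simp only [descents, Set.mem_ofPred_eq, ← h.descent_iff]
  exact ⟨fun hp => hp.2.2, fun hp => have hb := bounds_of_inversion (Nat.lt_succ_self p) hp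
    ⟨hb.1, hb.2, hp⟩⟩

lemma letter_eq_self {i : ℕ} (hi : ¬ (d ≤ i ∧ i ≤ d + 2 * k + 1)) : letter w i = i := by
  refine apply_eq_self_of_cut ⟨letter_injective w, letter_surjective w⟩ (fun q hq => ?_)
    fun q hq => ?_
  all_goals
    refine (letter_lt_or_gt w hq.ne).resolve_right fun hlt => ?_
    obtain ⟨a, b, _, hb, rfl, rfl⟩ := h.exists_of_inversion hq hlt
    omega

lemma bumped_eq : bumped (letter w) n = tops (letter w) d (k + 1) := by
  ext z
  simp only [bumped, h.rows_snd_eq_descentTops, Set.mem_image, Finset.mem_coe, mem_descentTops,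
    tops, Set.mem_Iio]
  constructor
  · rintro ⟨_, ⟨q, -, hq, rfl⟩, rfl⟩
    obtain ⟨i, hi, rfl⟩ := h.descent_iff.1 hq
    exact ⟨i, by omega, rfl⟩
  · rintro ⟨i, hi, rfl⟩
    have := h.bounds
    exact ⟨_, ⟨d + 2 * i, by omega, h.descent (by omega), rfl⟩, rfl⟩

lemma exists_of_mem_inversions {a b : ℕ} (hab : (a, b) ∈ inversions w) :
    ∃ i j, i ≤ j ∧ j ≤ k ∧ a = letter w (d + 2 * i) ∧ b = letter w (d + 2 * j + 1) := by
  obtain ⟨p, rfl⟩ := letter_surjective w a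
  obtain ⟨q, rfl⟩ := letter_surjective w b
  obtain ⟨i, j, hij, hj, rfl, rfl⟩ :=
    h.exists_of_inversion (letter_mem_inversions.1 hab).1 (letter_mem_inversions.1 hab).2
  exact ⟨i, j, hij, hj, rfl, rfl⟩

end IsBlock

end BlockPermutation

/-! ### Minimal crowded permutations are blocks -/

section Minimal

/-- The tops and the bottoms of the descents in `D` are distinct. -/
lemma Avoids321.two_mul_card_le {f : ℕ → ℕ} (h321 : Avoids321 f) (hf : f.Injective)
    {D : Finset ℕ} (hD : ∀ p ∈ D, f (p + 1) < f p) {a b : ℕ} (ha : ∀ p ∈ D, a < f (p + 1))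
    (hb : ∀ p ∈ D, f p ≤ b) : 2 * D.card ≤ b - a := by
  have hdisj : Disjoint D (D.image Nat.succ) := by
    rw [Finset.disjoint_right]
    intro p hp hpD
    obtain ⟨q, hq, rfl⟩ := Finset.mem_image.1 hp
    exact h321 (Nat.lt_succ_self q) (Nat.lt_succ_self _) (hD q hq) (hD _ hpD)
  have hmaps : ∀ q ∈ D ∪ D.image Nat.succ, f q ∈ Finset.Ioc a b := by
    intro q hq
    rw [Finset.mem_Ioc]
    rcases Finset.mem_union.1 hq with hq | hq
    · exact ⟨(ha q hq).trans (hD q hq), hb q hq⟩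
    · obtain ⟨p, hp, rfl⟩ := Finset.mem_image.1 hq
      exact ⟨ha p hp, (hD p hp).le.trans (hb p hp)⟩
  have hcard := Finset.card_le_card_of_injOn f hmaps hf.injOn
  rw [Finset.card_union_of_disjoint hdisj, Finset.card_image_of_injective _ Nat.succ_injective,
    Nat.card_Ioc] at hcard
  omega

lemma exists_forall_mem_iff_eq_add_two_mul {S : Set ℕ} {e : ℕ} (he : IsGreatest S e)
    (hsucc : ∀ p ∈ S, p + 1 ∉ S) (hadd : ∀ p ∈ S, p < e → p + 2 ∈ S) :
    ∃ d k, ∀ p, p ∈ S ↔ ∃ i ≤ k, p = d + 2 * i := by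
  obtain ⟨d, hd, hmin⟩ : ∃ d, IsLeast S d :=
    ⟨sInf S, Nat.sInf_mem ⟨e, he.1⟩, fun _ hp => Nat.sInf_le hp⟩
  have hmem (i : ℕ) : d + 2 * i ≤ e → d + 2 * i ∈ S := by
    induction i with
    | zero => exact fun _ => hd
    | succ i ih =>
      intro hi
      exact hadd (d + 2 * i) (ih (by omega)) (by omega)
  have hform : ∀ p ∈ S, ∃ i, p = d + 2 * i := by
    intro p hp
    have hdp := hmin hp
    have hpe := he.2 hp
    obtain ⟨i, hi | hi⟩ := Nat.even_or_odd' (p - d)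
    · exact ⟨i, by omega⟩
    · obtain rfl : p = d + 2 * i + 1 := by omega
      exact absurd hp (hsucc _ (hmem i (by omega)))
  obtain ⟨k, rfl⟩ := hform e he.1
  refine ⟨d, k, fun p => ⟨fun hp => ?_, ?_⟩⟩
  · obtain ⟨i, rfl⟩ := hform p hp
    have := he.2 hp
    exact ⟨i, by omega, rfl⟩
  · rintro ⟨i, hi, rfl⟩
    exact hmem i (by omega)

namespace IsMinimalCrowded

variable {w : Equiv.Perm (Fin n)} (hw : IsMinimalCrowded w) {p q m j e : ℕ}
include hw

lemma avoids321 : Avoids321 (letter w) := (mem_crowdedFC_iff.1 hw.1).1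

lemma isCrowded : IsCrowded (bumped (letter w) n) := (mem_crowdedFC_iff.1 hw.1).2

lemma isUncrowded_swapAt (hp : letter w (p + 2) < letter w (p + 1)) :
    IsUncrowded (bumped (swapAt (letter w) (p + 1)) n) := by
  by_contra hcrowded
  obtain ⟨i, hi⟩ := exists_fin_of_descent hp
  obtain rfl : (i : ℕ) = p := by omega
  have hle := rightWeakLE_of_descent hp
  have heq : w * simpleReflection i = w := hw.2 _ (mem_crowdedFC_iff.2
    ⟨hw.avoids321.of_rightWeakLE hle, letter_mul_simpleReflection w i ▸ hcrowded⟩) hle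
  have hswap := ascent_mul_simpleReflection hp
  rw [heq] at hswap
  exact hp.not_gt hswap

/-- Otherwise undoing the descent would not change the second row. -/
lemma rows_swapAt_ne (hp : letter w (p + 2) < letter w (p + 1)) (hm : p + 2 ≤ m) (hmn : m ≤ n) :
    rows (swapAt (letter w) (p + 1)) m ≠ rows (letter w) m := by
  intro hrows
  have hun := hw.isUncrowded_swapAt hp
  rw [bumped, rows_congr_after hrows hmn fun q hq => swapAt_of_ne _ (by omega) (by omega)] at hun
  exact hw.isCrowded hun

lemma row_lt (hp : letter w (p + 2) < letter w (p + 1)) {y : ℕ}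
    (hy : y ∈ (rows (letter w) p).1) : y < letter w (p + 2) := by
  by_contra! hle
  have hne : letter w (p + 2) ≠ y := by
    rintro rfl
    exact (notMem_rows (letter_injective w) (by omega)).1 hy
  have hmax : ∀ y ∈ (rows (letter w) p).1, y < letter w (p + 1) := by
    intro y hy
    obtain ⟨q, hq, rfl⟩ := exists_of_mem_rows_fst hy
    exact hw.avoids321.lt_of_inversion (letter_injective w) (by omega) (by omega) hp
  obtain ⟨z, hz⟩ := exists_bumps hy (hle.lt_of_ne hne)
  exact hw.rows_swapAt_ne hp le_rfl (bounds_of_inversion (by omega) hp).2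
    (rows_swapAt_eq_of_bumps hmax hz)

lemma lt_third (hp : letter w (p + 1) < letter w p) : letter w p < letter w (p + 2) := by
  obtain ⟨p, rfl⟩ := Nat.exists_eq_add_of_le' (bounds_of_inversion (Nat.lt_succ_self p) hp).1
  refine (letter_lt_or_gt w (by omega)).resolve_right fun hlt => ?_
  have hasc : letter w (p + 2) < letter w (p + 3) :=
    (letter_lt_or_gt w (by omega)).resolve_right fun h =>
      hw.avoids321 (Nat.lt_succ_self _) (Nat.lt_succ_self _) hp h
  exact hw.rows_swapAt_ne hp (Nat.le_succ _) (bounds_of_inversion (by omega) hlt).2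
    (rows_swapAt_eq_of_between (fun y hy => hw.row_lt hp hy) hasc hlt)

lemma lt_of_ascent (hp : letter w p < letter w (p + 1)) (hq : q ≤ p) :
    letter w q < letter w (p + 1) :=
  FCPerm.lt_of_ascent (letter_injective w) (fun _ h => hw.lt_third h) hp hq

lemma rows_snd_eq_descentTops (p : ℕ) : (rows (letter w) p).2 = descentTops (letter w) p :=
  FCPerm.rows_snd_eq_descentTops (letter_injective w) (fun _ hp _ hq => hw.lt_of_ascent hp hq)
    (fun _ hp _ _ hy => hw.row_lt hp hy) p

lemma descent_of_lt (hp : letter w (p + 1) < letter w p) (hqp : q < p)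
    (hlt : letter w (p + 1) < letter w q) : letter w (q + 1) < letter w q := by
  obtain ⟨p, rfl⟩ := Nat.exists_eq_add_of_le' (bounds_of_inversion (Nat.lt_succ_self p) hp).1
  have hq := bounds_of_inversion (by omega) hlt
  rcases (mem_rows (f := letter w)).2 ⟨q, ⟨hq.1, Nat.lt_succ_iff.1 hqp⟩, rfl⟩ with hrow | hbumped
  · exact absurd hlt (hw.row_lt hp hrow).not_gt
  · rw [hw.rows_snd_eq_descentTops, mem_descentTops] at hbumped
    obtain ⟨r, -, hr, hrq⟩ := hbumped
    rwa [letter_injective w hrq] at hr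

lemma mem_bumped {z : ℤ} : z ∈ bumped (letter w) n ↔
    ∃ p, letter w (p + 1) < letter w p ∧ (letter w p : ℤ) = z := by
  simp only [bumped, hw.rows_snd_eq_descentTops, Set.mem_image, Finset.mem_coe, mem_descentTops]
  constructor
  · rintro ⟨_, ⟨q, -, hq, rfl⟩, rfl⟩
    exact ⟨q, hq, rfl⟩
  · rintro ⟨q, hq, rfl⟩
    exact ⟨_, ⟨q, bounds_of_inversion (Nat.lt_succ_self q) hq, hq, rfl⟩, rfl⟩

lemma isUncrowded_diff (hp : letter w (p + 1) < letter w p)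
    (hlater : ∀ q, p + 1 < q → letter w p < letter w q) :
    IsUncrowded (bumped (letter w) n \ {(letter w p : ℤ)}) := by
  obtain ⟨hp1, hn⟩ := bounds_of_inversion (Nat.lt_succ_self p) hp
  obtain ⟨p, rfl⟩ := Nat.exists_eq_add_of_le' hp1
  refine (hw.isUncrowded_swapAt hp).mono ?_
  rintro _ ⟨⟨z, hz, rfl⟩, hne⟩
  refine ⟨z, (Finset.mem_insert.1 (rows_snd_subset_swapAt (fun y hy => hw.row_lt hp hy) hp hlater
    hn hz)).resolve_left ?_, rfl⟩
  rintro rfl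
  exact hne rfl

lemma exists_isGreatest_descent : ∃ e, IsGreatest {p | letter w (p + 1) < letter w p} e := by
  refine BddAbove.exists_isGreatest_of_nonempty ⟨n, fun p hp => ?_⟩ ?_
  · exact (Nat.le_succ p).trans (bounds_of_inversion (Nat.lt_succ_self p) hp).2
  · by_contra hempty
    have hbumped : bumped (letter w) n = ∅ := by
      refine Set.eq_empty_of_forall_notMem fun z hz => hempty ?_
      obtain ⟨p, hp, -⟩ := hw.mem_bumped.1 hz
      exact ⟨p, hp⟩
    refine hw.isCrowded fun x y hx => ?_
    rw [hbumped, Set.inter_empty, Set.ncard_empty]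
    omega

lemma top_lt_top (hq : letter w (q + 1) < letter w q) (hpq : p < q) : letter w p < letter w q :=
  hw.avoids321.lt_of_inversion (letter_injective w) hpq (Nat.lt_succ_self q) hq

lemma top_le_top (he : IsGreatest {p | letter w (p + 1) < letter w p} e)
    (hp : letter w (p + 1) < letter w p) : letter w p ≤ letter w e := by
  rcases (he.2 hp).eq_or_lt with rfl | hpe
  · exact le_rfl
  · exact (hw.top_lt_top he.1 hpe).le

lemma isUncrowded_diff_of_isGreatest (he : IsGreatest {p | letter w (p + 1) < letter w p} e) :
    IsUncrowded (bumped (letter w) n \ {(letter w e : ℤ)}) := by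
  refine hw.isUncrowded_diff he.1 fun q hq => ?_
  obtain ⟨q, rfl⟩ := Nat.exists_eq_succ_of_ne_zero (show q ≠ 0 by omega)
  refine hw.lt_of_ascent ((letter_lt_or_gt w (by omega)).resolve_right fun hdesc => ?_) (by omega)
  have := he.2 hdesc
  omega

lemma ncard_Ioc_inter_bumped_le (he : IsGreatest {p | letter w (p + 1) < letter w p} e)
    (hj : letter w (j + 1) < letter w j) :
    (Set.Ioc (letter w j : ℤ) (letter w e) ∩ bumped (letter w) n).ncard ≤
      ((Finset.Ioc j e).filter fun p => letter w (p + 1) < letter w p).card := by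
  set D := (Finset.Ioc j e).filter fun p => letter w (p + 1) < letter w p
  have hsub : Set.Ioc (letter w j : ℤ) (letter w e) ∩ bumped (letter w) n ⊆
      D.image fun p => (letter w p : ℤ) := by
    rintro z ⟨hz, hzb⟩
    obtain ⟨p, hp, rfl⟩ := hw.mem_bumped.1 hzb
    have hjp : j < p := by
      by_contra! hpj
      rcases hpj.eq_or_lt with rfl | hpj
      · exact hz.1.false
      · exact (Int.ofNat_lt.1 hz.1).not_gt (hw.top_lt_top hj hpj)
    exact Finset.mem_coe.2 (Finset.mem_image_of_mem _
      (Finset.mem_filter.2 ⟨Finset.mem_Ioc.2 ⟨hjp, he.2 hp⟩, hp⟩))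
  exact (Set.ncard_le_ncard hsub (Finset.finite_toSet _)).trans
    ((Set.ncard_coe_finset _).trans_le Finset.card_image_le)

/-- If not, the tops after `j` are both dense, as every interval witnessing crowdedness contains
the tops of `j` and `e`, and sparse, as the bottoms of these tops also exceed the top of `j`. -/
lemma exists_lt_top (he : IsGreatest {p | letter w (p + 1) < letter w p} e)
    (hj : letter w (j + 1) < letter w j) (hje : j < e) :
    ∃ q, j + 1 < q ∧ letter w q < letter w j := by
  by_contra! hno
  have hlater : ∀ q, j + 1 < q → letter w j < letter w q := fun q hq =>
    (hno q hq).lt_of_ne ((letter_injective w).ne (by omega))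
  have hub : (letter w e : ℤ) ∈ upperBounds (bumped (letter w) n) := fun z hz => by
    obtain ⟨p, hp, rfl⟩ := hw.mem_bumped.1 hz
    exact Int.ofNat_le.2 (hw.top_le_top he hp)
  have hlt := hw.top_lt_top he.1 hje
  have hdense := hw.isCrowded.sub_lt_two_mul_ncard (Int.ofNat_lt.2 hlt)
    (hw.isUncrowded_diff hj hlater) (hw.isUncrowded_diff_of_isGreatest he) hub
  have hcard := hw.ncard_Ioc_inter_bumped_le he hj
  set D := (Finset.Ioc j e).filter fun p => letter w (p + 1) < letter w p with hD
  have hsparse : 2 * D.card ≤ letter w e - letter w j := by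
    refine hw.avoids321.two_mul_card_le (letter_injective w) (fun p hp => ?_) (fun p hp => ?_)
      fun p hp => ?_ <;> rw [hD, Finset.mem_filter, Finset.mem_Ioc] at hp
    · exact hp.2
    · exact hlater _ (by omega)
    · exact hw.top_le_top he hp.2
  omega

lemma descent_add_two (he : IsGreatest {p | letter w (p + 1) < letter w p} e)
    (hj : letter w (j + 1) < letter w j) (hje : j < e) :
    letter w (j + 3) < letter w (j + 2) ∧ letter w (j + 3) < letter w j := by
  obtain ⟨q, hq, hlt⟩ := hw.exists_lt_top he hj hje
  obtain ⟨r, rfl⟩ := Nat.exists_eq_succ_of_ne_zero (show q ≠ 0 by omega)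
  have hr : letter w (r + 1) < letter w r :=
    (letter_lt_or_gt w (by omega)).resolve_left fun hasc =>
      hlt.not_gt (hw.lt_of_ascent hasc (by omega))
  have hthird := hw.lt_third hj
  rcases lt_trichotomy r (j + 2) with h | rfl | h
  · obtain rfl : r = j + 1 := by omega
    exact absurd hlt hthird.not_gt
  · exact ⟨hr, hlt⟩
  · have hdesc : letter w (j + 3) < letter w (j + 2) :=
      hw.descent_of_lt hr h (hlt.trans hthird)
    have hbottom : letter w (j + 3) < letter w (r + 1) :=
      (letter_lt_or_gt w (by omega)).resolve_right fun h' =>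
        hw.avoids321 (Nat.lt_succ_self _) (by omega) hdesc h'
    exact ⟨hdesc, hbottom.trans hlt⟩

theorem exists_isBlock : ∃ d k, IsBlock (letter w) d k := by
  obtain ⟨e, he⟩ := hw.exists_isGreatest_descent
  obtain ⟨d, k, hdesc⟩ := exists_forall_mem_iff_eq_add_two_mul he
    (fun p hp hp' => hw.avoids321 (Nat.lt_succ_self _) (Nat.lt_succ_self _) hp hp')
    fun p hp hpe => (hw.descent_add_two he hp hpe).1
  refine ⟨d, k, IsBlock.of_descent_iff (letter_injective w) hdesc (fun _ h => hw.lt_third h)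
    (fun i hi => ?_) fun _ _ hp hqp hlt => hw.descent_of_lt hp hqp hlt⟩
  have hlt : d + 2 * i < e := by
    have := he.2 ((hdesc (d + 2 * k)).2 ⟨k, le_rfl, rfl⟩)
    omega
  exact (hw.descent_add_two he ((hdesc _).2 ⟨i, hi.le, rfl⟩) hlt).2

theorem isThinBlock {d k : ℕ} (h : IsBlock (letter w) d k) : IsThinBlock (letter w) d k := by
  refine ⟨h, fun i hi => (letter_lt_or_gt w (by omega)).resolve_right fun hlt => ?_⟩
  have hun := hw.isUncrowded_diff (h.descent le_rfl) fun q hq =>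
    h.lt_of_forall_ne_bottom (fun _ _ => by omega) (by omega)
  refine h.isCrowded_tops (letter_surjective w) hi hlt (hun.mono ?_)
  rw [h.bumped_eq]
  rintro _ ⟨j, hj, rfl⟩
  refine ⟨⟨j, Nat.lt_succ_of_lt hj, rfl⟩, ?_⟩
  exact (Int.ofNat_lt.2 (h.top_strictMono hj)).ne

end IsMinimalCrowded

end Minimal

/-! ### Thin blocks with crowded tops are minimal -/

section Characterization

variable {v w : Equiv.Perm (Fin n)} {d k : ℕ}

lemma RightWeakLE.lt_of_letter_eq (hle : RightWeakLE v w) {p q p' q' : ℕ} (hpq : p < q)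
    (hlt : letter w p < letter w q) (hp : letter v p' = letter w p)
    (hq : letter v q' = letter w q) : p' < q' := by
  have hne : p' ≠ q' := by
    rintro rfl
    exact hlt.ne (hp.symm.trans hq)
  refine hne.lt_or_gt.resolve_right fun hqp => ?_
  have hinv := hle.inversions_subset (letter_mem_inversions.2 ⟨hqp, by rwa [hp, hq]⟩)
  rw [hp, hq, letter_mem_inversions] at hinv
  exact hpq.not_gt hinv.1

lemma IsBlock.exists_of_bumps (h : IsBlock (letter w) d k) (hle : RightWeakLE v w) {r z : ℕ}
    (hz : Bumps (rows (letter v) r).1 (letter v (r + 1)) z) :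
    ∃ i j, i ≤ j ∧ j ≤ k ∧ z = letter w (d + 2 * i) ∧
      letter v (r + 1) = letter w (d + 2 * j + 1) := by
  obtain ⟨q, hq, rfl⟩ := exists_of_mem_rows_fst hz.mem
  exact h.exists_of_mem_inversions
    (hle.inversions_subset (letter_mem_inversions.2 ⟨Nat.lt_succ_of_le hq.2, hz.lt⟩))

namespace IsThinBlock

variable (h : IsThinBlock (letter w) d k) (hle : RightWeakLE v w)
include h hle

lemma last_top_mem_rows_snd (hv : IsCrowded (bumped (letter v) n)) :
    letter w (d + 2 * k) ∈ (rows (letter v) n).2 := by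
  by_contra hnot
  refine hv ((h.isUncrowded_tops (letter_surjective w)).mono ?_)
  rintro _ ⟨z, hz, rfl⟩
  obtain ⟨r, -, hr⟩ := mem_rows_snd_iff.1 hz
  obtain ⟨i, j, hij, hj, rfl, -⟩ := h.exists_of_bumps hle hr
  refine ⟨i, (hij.trans hj).lt_of_ne ?_, rfl⟩
  rintro rfl
  exact hnot hz

lemma exists_bumps_last (hv : IsCrowded (bumped (letter v) n)) :
    ∃ r, Bumps (rows (letter v) r).1 (letter v (r + 1)) (letter w (d + 2 * k)) ∧
      letter v (r + 1) = letter w (d + 2 * k + 1) := by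
  obtain ⟨r, -, hr⟩ := mem_rows_snd_iff.1 (h.last_top_mem_rows_snd hle hv)
  obtain ⟨i, j, hij, hj, hi, hb⟩ := h.exists_of_bumps hle hr
  have := letter_injective w hi
  obtain rfl : j = k := by omega
  exact ⟨r, hr, hb⟩

/-- As the next bottom bumps the next top, the top `i` must have been bumped before. -/
lemma exists_bumps_of_succ {i r : ℕ} (hi : i < k)
    (hr : Bumps (rows (letter v) r).1 (letter v (r + 1)) (letter w (d + 2 * (i + 1))))
    (hb : letter v (r + 1) = letter w (d + 2 * (i + 1) + 1)) :
    ∃ s, Bumps (rows (letter v) s).1 (letter v (s + 1)) (letter w (d + 2 * i)) ∧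
      letter v (s + 1) = letter w (d + 2 * i + 1) := by
  have htop : letter w (d + 2 * i) < letter w (d + 2 * (i + 1)) :=
    h.top_strictMono (Nat.lt_succ_self i)
  have hcross : letter w (d + 2 * (i + 1) + 1) < letter w (d + 2 * i) := h.cross hi
  obtain ⟨t, ht⟩ := letter_surjective v (letter w (d + 2 * i))
  have hbumped : letter w (d + 2 * i) ∈ (rows (letter v) r).2 := by
    obtain ⟨q, hq, hqe⟩ := exists_of_mem_rows_fst hr.mem
    have htq : t < q := hle.lt_of_letter_eq (by omega) htop ht hqe
    have ht0 : t ≠ 0 := by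
      rintro rfl
      rw [letter_zero] at ht
      omega
    refine ((mem_rows (f := letter v)).2 ⟨t, by omega, ht⟩).resolve_left fun hrow => ?_
    exact htop.not_ge (hr.le hrow (hb.trans_lt hcross))
  obtain ⟨s, hsr, hs⟩ := mem_rows_snd_iff.1 hbumped
  obtain ⟨i', j, hij, hj, he, hbj⟩ := h.exists_of_bumps hle hs
  obtain rfl : i = i' := by
    have := letter_injective w he
    omega
  have hj_lt : j < i + 3 := h.lt_add_three hj (hbj ▸ hs.lt)
  have hj_ne : j ≠ i + 1 := by
    rintro rfl
    exact hsr.ne (Nat.succ_injective (letter_injective v (hbj.trans hb.symm)))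
  have hj_le : j ≤ i + 1 := by
    by_contra! hij'
    have := hle.lt_of_letter_eq (by omega) (h.bottom_strictMono hij') hb hbj
    omega
  obtain rfl : i = j := by omega
  exact ⟨s, hs, hbj⟩

lemma exists_bumps (hv : IsCrowded (bumped (letter v) n)) {i : ℕ} (hi : i ≤ k) :
    ∃ r, Bumps (rows (letter v) r).1 (letter v (r + 1)) (letter w (d + 2 * i)) ∧
      letter v (r + 1) = letter w (d + 2 * i + 1) := by
  induction hi using Nat.decreasingInduction with
  | self => exact h.exists_bumps_last hle hv
  | of_succ i hi ih =>
    obtain ⟨r, hr, hb⟩ := ih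
    exact h.exists_bumps_of_succ hle hi hr hb

end IsThinBlock

/-- A crowded permutation below `w` has all inversions of `w` at descents of `w`, so it is `w`. -/
theorem IsThinBlock.isMinimalCrowded (h : IsThinBlock (letter w) d k)
    (hcrowded : IsCrowded (tops (letter w) d (k + 1))) : IsMinimalCrowded w := by
  refine ⟨mem_crowdedFC_iff.2 ⟨h.avoids321, h.bumped_eq ▸ hcrowded⟩, fun v hv hle => ?_⟩
  by_contra hne
  obtain ⟨p, hp, hnot⟩ := hle.exists_descent_notMem_inversions hne
  obtain ⟨i, hi, rfl⟩ := h.descent_iff.1 hp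
  obtain ⟨r, hr, hb⟩ := h.exists_bumps hle (mem_crowdedFC_iff.1 hv).2 hi
  obtain ⟨q, hq, hqe⟩ := exists_of_mem_rows_fst hr.mem
  rw [← hb, ← hqe, letter_mem_inversions, hqe] at hnot
  exact hnot ⟨Nat.lt_succ_of_le hq.2, hr.lt⟩

theorem isMinimalCrowded_iff : IsMinimalCrowded w ↔
    ∃ d k, IsThinBlock (letter w) d k ∧ IsCrowded (tops (letter w) d (k + 1)) := by
  constructor
  · intro hw
    obtain ⟨d, k, h⟩ := hw.exists_isBlock
    exact ⟨d, k, hw.isThinBlock h, h.bumped_eq ▸ hw.isCrowded⟩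
  · rintro ⟨d, k, h, hcrowded⟩
    exact h.isMinimalCrowded hcrowded

end Characterization

/-! ### The patterns `415263` and `315264` -/

section Patterns

lemma sameRelativeOrder_415263_iff {v : Fin 6 → ℕ} : SameRelativeOrder v ![4, 1, 5, 2, 6, 3] ↔
    v 1 < v 3 ∧ v 3 < v 5 ∧ v 5 < v 0 ∧ v 0 < v 2 ∧ v 2 < v 4 := by
  constructor
  · intro h
    refine ⟨?_, ?_, ?_, ?_, ?_⟩ <;> exact (h _ _).2 (by decide)
  · rintro ⟨h1, h2, h3, h4, h5⟩ i j
    fin_cases i <;> fin_cases j <;> dsimp <;> omega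

lemma sameRelativeOrder_315264_iff {v : Fin 6 → ℕ} : SameRelativeOrder v ![3, 1, 5, 2, 6, 4] ↔
    v 1 < v 3 ∧ v 3 < v 0 ∧ v 0 < v 5 ∧ v 5 < v 2 ∧ v 2 < v 4 := by
  constructor
  · intro h
    refine ⟨?_, ?_, ?_, ?_, ?_⟩ <;> exact (h _ _).2 (by decide)
  · rintro ⟨h1, h2, h3, h4, h5⟩ i j
    fin_cases i <;> fin_cases j <;> dsimp <;> omega

namespace IsBlock

variable {f : ℕ → ℕ} {d k i : ℕ} (h : IsBlock f d k)
include h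

lemma sameRelativeOrder_415263 (hlt : f (d + 2 * (i + 2) + 1) < f (d + 2 * i)) :
    SameRelativeOrder (fun j : Fin 6 => f (d + 2 * i + j)) ![4, 1, 5, 2, 6, 3] :=
  sameRelativeOrder_415263_iff.2 ⟨h.bottom_strictMono (Nat.lt_succ_self i),
    h.bottom_strictMono (Nat.lt_succ_self (i + 1)), hlt, h.top_strictMono (Nat.lt_succ_self i),
    h.top_strictMono (Nat.lt_succ_self (i + 1))⟩

lemma sameRelativeOrder_415263_or_315264 (hi : i + 2 ≤ k) :
    SameRelativeOrder (fun j : Fin 6 => f (d + 2 * i + j)) ![4, 1, 5, 2, 6, 3] ∨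
      SameRelativeOrder (fun j : Fin 6 => f (d + 2 * i + j)) ![3, 1, 5, 2, 6, 4] := by
  have hne : f (d + 2 * (i + 2) + 1) ≠ f (d + 2 * i) := h.injective.ne (by omega)
  refine hne.lt_or_gt.imp h.sameRelativeOrder_415263 fun hgt => ?_
  exact sameRelativeOrder_315264_iff.2 ⟨h.bottom_strictMono (Nat.lt_succ_self i),
    h.cross (by omega), hgt, h.cross (i := i + 1) (by omega),
    h.top_strictMono (Nat.lt_succ_self (i + 1))⟩

end IsBlock

section Permutation

variable {w : Equiv.Perm (Fin n)} {d k : ℕ}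

lemma IsBlock.exists_isOccurrence (h : IsBlock (letter w) d k)
    (hcrowded : IsCrowded (tops (letter w) d (k + 1))) :
    ∃ g : Fin 6 → ℕ, IsOccurrence ![4, 1, 5, 2, 6, 3] w g := by
  obtain ⟨i, hlt⟩ : ∃ i, letter w (d + 2 * (i + 2) + 1) < letter w (d + 2 * i) := by
    by_contra! hno
    exact hcrowded (h.isUncrowded_tops (letter_surjective w) fun i _ =>
      (hno i).lt_of_ne ((letter_injective w).ne (by omega)))
  have hbounds := bounds_of_inversion (by omega) hlt
  exact ⟨fun j => d + 2 * i + j, fun _ _ hab => Nat.add_lt_add_left hab _,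
    fun _ => ⟨by dsimp only; omega, by dsimp only; omega⟩, h.sameRelativeOrder_415263 hlt⟩

lemma IsBlock.two_le (h : IsBlock (letter w) d k)
    (hcrowded : IsCrowded (tops (letter w) d (k + 1))) : 2 ≤ k := by
  by_contra hk
  exact hcrowded (h.isUncrowded_tops (letter_surjective w) fun i hi => by omega)

/-- The first letter of an occurrence is a top and its letters `1`, `2`, `3` are bottoms, at most
two steps later. -/
lemma IsThinBlock.isConsecutive (h : IsThinBlock (letter w) d k) {g : Fin 6 → ℕ}
    (hg : IsOccurrence ![4, 1, 5, 2, 6, 3] w g) : IsConsecutive g := by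
  obtain ⟨hmono, -, hord⟩ := hg
  obtain ⟨h13, h35, h50, -, -⟩ := sameRelativeOrder_415263_iff.1 hord
  have hg' : g 0 < g 1 ∧ g 1 < g 2 ∧ g 2 < g 3 ∧ g 3 < g 4 ∧ g 4 < g 5 := by
    refine ⟨?_, ?_, ?_, ?_, ?_⟩ <;> exact hmono (by decide)
  obtain ⟨i, j₁, hij, -, h0, h1⟩ := h.exists_of_inversion hg'.1 (h13.trans (h35.trans h50))
  obtain ⟨-, j₃, -, -, -, h3⟩ := h.exists_of_inversion (hmono (by decide)) (h35.trans h50)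
  obtain ⟨-, j₅, -, hj, -, h5⟩ := h.exists_of_inversion (hmono (by decide)) h50
  simp only [h0, h5] at h50
  have hj_lt : j₅ < i + 3 := h.lt_add_three hj h50
  intro a b hab
  fin_cases a <;> fin_cases b <;> dsimp at hab ⊢ <;> omega

lemma IsBlock.isThinBlock (h : IsBlock (letter w) d k)
    (hcons : ∀ g : Fin 6 → ℕ, IsOccurrence ![4, 1, 5, 2, 6, 3] w g → IsConsecutive g) :
    IsThinBlock (letter w) d k := by
  refine ⟨h, fun i hi => (letter_lt_or_gt w (by omega)).resolve_right fun hlt => ?_⟩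
  have hocc : IsOccurrence ![4, 1, 5, 2, 6, 3] w ![d + 2 * i, d + 2 * i + 1, d + 2 * i + 2,
      d + 2 * i + 3, d + 2 * i + 4, d + 2 * (i + 3) + 1] := by
    have := h.bounds
    refine ⟨Fin.strictMono_iff_lt_succ.2 fun j => ?_, fun j => ?_, ?_⟩
    · fin_cases j <;> dsimp <;> omega
    · fin_cases j <;> dsimp <;> omega
    · exact sameRelativeOrder_415263_iff.2 ⟨h.bottom_strictMono (Nat.lt_succ_self i),
        h.bottom_strictMono (show i + 1 < i + 3 by omega), hlt,
        h.top_strictMono (Nat.lt_succ_self i), h.top_strictMono (Nat.lt_succ_self (i + 1))⟩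
  have : d + 2 * (i + 3) + 1 = d + 2 * i + 4 + 1 := hcons _ hocc 4 5 rfl
  omega

end Permutation

lemma apply_mem_of_forall_notMem {β : Type*} {g : β → β} (hg : g.Injective) {s : Set β}
    (hs : ∀ x ∉ s, g x = x) {x : β} (hx : x ∈ s) : g x ∈ s := by
  by_contra hgx
  exact hgx ((hg (hs _ hgx)).symm ▸ hx)

/-- Each pair of neighbouring descents lies in a window of three. -/
lemma lt_of_forall_window {f : ℕ → ℕ} {d k : ℕ} (hk : 2 ≤ k) (hwin : ∀ i, i + 2 ≤ k →
      SameRelativeOrder (fun j : Fin 6 => f (d + 2 * i + j)) ![4, 1, 5, 2, 6, 3] ∨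
        SameRelativeOrder (fun j : Fin 6 => f (d + 2 * i + j)) ![3, 1, 5, 2, 6, 4])
    {i : ℕ} (hi : i < k) : f (d + 2 * i + 1) < f (d + 2 * i + 3) ∧
      f (d + 2 * i + 3) < f (d + 2 * i) ∧ f (d + 2 * i) < f (d + 2 * i + 2) := by
  simp only [sameRelativeOrder_415263_iff, sameRelativeOrder_315264_iff] at hwin
  by_cases hik : i + 2 ≤ k
  · rcases hwin i hik with ⟨h13, h35, h50, h02, -⟩ | ⟨h13, h30, h05, h52, -⟩
    · exact ⟨h13, h35.trans h50, h02⟩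
    · exact ⟨h13, h30, h05.trans h52⟩
  · obtain ⟨i, rfl⟩ := Nat.exists_eq_succ_of_ne_zero (show i ≠ 0 by omega)
    rcases hwin i (by omega) with ⟨-, h35, h50, h02, h24⟩ | ⟨-, h30, h05, h52, h24⟩
    · exact ⟨h35, h50.trans h02, h24⟩
    · exact ⟨h30.trans h05, h52, h24⟩

lemma IsBlock.of_descents_eq {w : Equiv.Perm (Fin n)} {d k : ℕ}
    (hdesc : descents w = {j | ∃ i : ℕ, i ≤ k ∧ j = d + 2 * i})
    (hfix : ∀ i, ¬ (d ≤ i ∧ i ≤ d + 2 * k + 1) → letter w i = i)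
    (hwin : ∀ i < k, letter w (d + 2 * i + 1) < letter w (d + 2 * i + 3) ∧
      letter w (d + 2 * i + 3) < letter w (d + 2 * i) ∧
      letter w (d + 2 * i) < letter w (d + 2 * i + 2)) : IsBlock (letter w) d k := by
  have hdesc' (p : ℕ) : letter w (p + 1) < letter w p ↔ ∃ i ≤ k, p = d + 2 * i := by
    refine ⟨fun hp => ?_, fun hp => (hdesc.superset hp).2.2⟩
    have hbounds := bounds_of_inversion (Nat.lt_succ_self p) hp
    exact hdesc.subset ⟨hbounds.1, hbounds.2, hp⟩
  have hmem (i : ℕ) (hi : d ≤ i ∧ i ≤ d + 2 * k + 1) :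
      d ≤ letter w i ∧ letter w i ≤ d + 2 * k + 1 :=
    apply_mem_of_forall_notMem (s := Set.Icc d (d + 2 * k + 1)) (letter_injective w) hfix hi
  have hbottom : StrictMonoOn (fun j => letter w (d + 2 * j + 1)) (Set.Iic k) :=
    strictMonoOn_of_lt_add_one Set.ordConnected_Iic fun i _ _ hi => (hwin i hi).1
  refine IsBlock.of_descent_iff (letter_injective w) hdesc' (fun p hp => ?_)
    (fun i hi => (hwin i hi).2.1) fun p q hp hqp hlt => ?_
  · obtain ⟨i, hi, rfl⟩ := (hdesc' p).1 hp
    rcases hi.eq_or_lt with rfl | hi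
    · have := hmem (d + 2 * i) (by omega)
      rw [hfix (d + 2 * i + 2) (by omega)]
      omega
    · exact (hwin i hi).2.2
  · obtain ⟨j, hj, rfl⟩ := (hdesc' p).1 hp
    have hdq : d ≤ q := by
      by_contra! hqd
      have := hmem (d + 2 * j + 1) (by omega)
      rw [hfix q (by omega)] at hlt
      omega
    obtain ⟨i, hi | hi⟩ := Nat.even_or_odd' (q - d)
    · exact (hdesc' q).2 ⟨i, by omega, by omega⟩
    · obtain rfl : q = d + 2 * i + 1 := by omega
      exact absurd hlt (hbottom (by simp; omega) hj (by omega)).not_gt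

end Patterns

end FCPerm

theorem theorem5p15 (n : ℕ) (w : Equiv.Perm (Fin n)) :
    FCPerm.IsMinimalCrowded w ↔
      ∃ d k : ℕ, 2 ≤ k ∧
        FCPerm.descents w = {j | ∃ i : ℕ, i ≤ k ∧ j = d + 2 * i} ∧
        FCPerm.IsCrowded {z : ℤ | ∃ i : ℕ, i ≤ k ∧ z = (FCPerm.letter w (d + 2 * i) : ℤ)} ∧
        (∀ i : ℕ, 1 ≤ i → i ≤ n → ¬ (d ≤ i ∧ i ≤ d + 2 * k + 1) → FCPerm.letter w i = i) ∧
        ((∃ f : Fin 6 → ℕ, FCPerm.IsOccurrence ![4, 1, 5, 2, 6, 3] w f) ∧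
          ∀ f : Fin 6 → ℕ, FCPerm.IsOccurrence ![4, 1, 5, 2, 6, 3] w f →
            FCPerm.IsConsecutive f) ∧
        (∀ i : ℕ, i + 2 ≤ k →
          FCPerm.SameRelativeOrder (fun j : Fin 6 => FCPerm.letter w (d + 2 * i + (j : ℕ)))
              ![4, 1, 5, 2, 6, 3] ∨
            FCPerm.SameRelativeOrder (fun j : Fin 6 => FCPerm.letter w (d + 2 * i + (j : ℕ)))
              ![3, 1, 5, 2, 6, 4]) := by
  constructor
  · intro hw
    obtain ⟨d, k, h, hcrowded⟩ := FCPerm.isMinimalCrowded_iff.1 hw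
    exact ⟨d, k, h.two_le hcrowded, h.descents_eq, FCPerm.tops_succ_eq _ d k ▸ hcrowded,
      fun i _ _ hi => h.letter_eq_self hi,
      ⟨h.exists_isOccurrence hcrowded, fun g hg => h.isConsecutive hg⟩,
      fun i hi => h.sameRelativeOrder_415263_or_315264 hi⟩
  · rintro ⟨d, k, hk, hdesc, hcrowded, hfix, ⟨-, hcons⟩, hwin⟩
    have hfix' (i : ℕ) (hi : ¬ (d ≤ i ∧ i ≤ d + 2 * k + 1)) : FCPerm.letter w i = i := by
      by_cases hin : 1 ≤ i ∧ i ≤ n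
      · exact hfix i hin.1 hin.2 hi
      · exact FCPerm.letter_of_notMem w hin
    have h : FCPerm.IsBlock (FCPerm.letter w) d k :=
      .of_descents_eq hdesc hfix' fun i hi => FCPerm.lt_of_forall_window hk hwin hi
    exact FCPerm.isMinimalCrowded_iff.2
      ⟨d, k, h.isThinBlock hcons, FCPerm.tops_succ_eq (FCPerm.letter w) d k ▸ hcrowded⟩
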